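/- Let $I\subset\mathbb R$ be an interval (bounded or not) and let $\mathfrak F=\bigoplus_{n\ge 0}L^2_{\mathrm{sym}}(I^n)$ be the bosonic Fock space over $L^2(I)$, with vacuum $|\Omega\rangle$ and field operators $\psi(x),\psi^\dagger(x)$. For a matrix function $Q$ with entries in $L^1(I)$ and an interval $J\subset I$ put $$V_J=\mathcal P e^{\int_J Q}=\sum_{n\ge 0}\int_{t_1<\dots<t_n,\;t_i\in J}Q(t_1)\cdots Q(t_n)\,dt .$$ For $x_1<\dots<x_n$ in $I$ let $J_0,\dots,J_n$ be the successive intervals (from left to right) into which these points divide $I$. For matrix functions $K_1,\dots,K_n$ and a boundary matrix $B$ put $$c_{B,Q}(K_1,\dots,K_n;x)=\mathrm{Tr}\bigl(B\,V_{J_0}K_1(x_1)V_{J_1}K_2(x_2)\cdots K_n(x_n)V_{J_n}\bigr).$$ *cMPS.* Let $B\in M_D(\mathbb C)$, and let $Q,L:I\to M_D(\mathbb C)$ with $Q$ integrable and $L$ measurable. The continuous matrix product state with these tensors (bond dimension $D$) is $$|\psi[B,Q,L]\rangle=\sum_{n\ge0}\int_{x_1<\dots<x_n}c_{B,Q}(L,\dots,L;x)\,\psi^\dagger(x_1)\cdots\psi^\dagger(x_n)|\Omega\rangle\,dx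 ,$$ whenever this defines a vector of $\mathfrak F$. *cMPO.* Let $B\in M_D(\mathbb C)$, and let $Q,L,R,T:I\to M_D(\mathbb C)$ with $Q$ integrable and $L,R,T$ measurable. Put $l_x[\cdot]=\psi^\dagger(x)[\cdot]$, $r_x[\cdot]=[\cdot]\psi(x)$, $\mathrm{Ad}_x[\cdot]=\psi^\dagger(x)[\cdot]\psi(x)$. A bounded operator $O$ on $\mathfrak F$ is the continuous matrix product operator with these tensors (bond dimension $D$), $$O=\mathrm{Tr}_D\Bigl(B\,\mathcal P e^{\int_I dx\,(Q\otimes\mathrm{Id}+L\otimes l_x+R\otimes r_x+T\otimes\mathrm{Ad}_x)}\Bigr)\bigl(|\Omega\rangle\langle\Omega|\bigr),$$ if its matrix elements between vectors with finitely many nonzero particle sectors are given by the Dyson series $$\sum_{N\ge0}\;\sum_{(K_i,f^i)\in\{(L,l),(R,r),(T,\mathrm{Ad})\},\;1\le i\le N}\;\int_{x_1<\dots<x_N}c_{B,Q}(K_1,\dots,K_N;x)\,f^1_{x_1}\cdots f^N_{x_N}\bigl[|\Omega\rangle\langle\Omega|\bigr]\,dx ,$$ with absolutely convergent integrals. A cMPU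 is a unitary cMPO. **Proposition.** Let $|\psi_j\rangle=|\psi[B_j,Q_j,L_j]\rangle$, $j=1,\dots,m$, be pairwise orthonormal cMPS in $\mathfrak F$ with bond dimensions $D_j$, let $P_j=|\psi_j\rangle\langle\psi_j|$ and $a_1,\dots,a_m\in\mathbb R$. Then $$U=\mathbb 1+\sum_{j=1}^m\bigl(e^{ia_j}-1\bigr)P_j$$ is a cMPU with bond dimension $1+\sum_{j=1}^mD_j^2$. Moreover, the identity $\mathbb 1$ is the cMPO with the $1\times 1$ tensors $B=T=1$, $Q=L=R=0$; each $P_j$ is the cMPO with the tensors $$B_j\otimes\overline{B_j},\quad Q_j\otimes\mathbb 1+\mathbb 1\otimes\overline{Q_j},\quad L_j\otimes\mathbb 1,\quad \mathbb 1\otimes\overline{L_j},\quad 0$$ for $B,Q,L,R,T$ (bars denote entrywise conjugation); and $U$ is the cMPO whose tensors are the direct sum of those of $\mathbb 1$ and those of $P_1,\dots,P_m$, the boundary matrix of the $j$-th projector being multiplied by $e^{ia_j}-1$. -/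

import Mathlib

open MeasureTheory
open scoped Kronecker ENNReal InnerProductSpace

noncomputable section

namespace CMPO

/-! ### The bosonic Fock space over `L²(I)` -/

/-- Lebesgue measure on `Iⁿ`. -/
abbrev cubeMeasure (I : Set ℝ) (n : ℕ) : Measure (Fin n → ℝ) :=
  Measure.pi fun _ => (volume : Measure ℝ).restrict I

lemma measurePreserving_perm (I : Set ℝ) (n : ℕ) (σ : Equiv.Perm (Fin n)) :
    MeasurePreserving (fun x : Fin n → ℝ => x ∘ σ) (cubeMeasure I n) (cubeMeasure I n) := by
  have h := measurePreserving_piCongrLeft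
    (fun _ : Fin n => (volume : Measure ℝ).restrict I) σ.symm
  convert h using 1
  funext x i
  obtain ⟨j, rfl⟩ := σ.symm.surjective i
  simp [MeasurableEquiv.coe_piCongrLeft, Equiv.piCongrLeft_apply_apply]

/-- The action of a permutation of the particles on `L²(Iⁿ)`: `(σ f)(x) = f (x ∘ σ)`. -/
def permAct (I : Set ℝ) (n : ℕ) (σ : Equiv.Perm (Fin n)) :
    Lp ℂ 2 (cubeMeasure I n) →L[ℂ] Lp ℂ 2 (cubeMeasure I n) :=
  (Lp.compMeasurePreservingₗᵢ ℂ (fun x : Fin n → ℝ => x ∘ σ)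
    (measurePreserving_perm I n σ)).toContinuousLinearMap

/-- The `n`-particle space: the symmetric functions in `L²(Iⁿ)`. -/
def symL2 (I : Set ℝ) (n : ℕ) : Submodule ℂ (Lp ℂ 2 (cubeMeasure I n)) where
  carrier := {f | ∀ σ : Equiv.Perm (Fin n), permAct I n σ f = f}
  add_mem' hf hg σ := by rw [map_add, hf σ, hg σ]
  zero_mem' σ := map_zero _
  smul_mem' c f hf σ := by rw [map_smul, hf σ]

lemma isClosed_symL2 (I : Set ℝ) (n : ℕ) :
    IsClosed (symL2 I n : Set (Lp ℂ 2 (cubeMeasure I n))) := by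
  have : (symL2 I n : Set (Lp ℂ 2 (cubeMeasure I n))) =
      ⋂ σ : Equiv.Perm (Fin n), {f | permAct I n σ f = f} := by
    ext f; simp [symL2]
  rw [this]
  exact isClosed_iInter fun σ => isClosed_eq (permAct I n σ).continuous continuous_id

instance (I : Set ℝ) (n : ℕ) : CompleteSpace (symL2 I n) :=
  (isClosed_symL2 I n).completeSpace_coe

/-- The bosonic Fock space: the Hilbert direct sum over `n` of the `n`-particle spaces. A vector
`Φ` stands for `∑ₙ (n!)^(-1/2) ∫ dⁿx Φₙ(x₁,…,xₙ) ψ†(x₁)⋯ψ†(xₙ)|Ω⟩`. -/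
abbrev Fock (I : Set ℝ) : Type := lp (fun n : ℕ => symL2 I n) 2

/-- The `n`-particle wave function of a Fock vector. -/
def wave {I : Set ℝ} (Φ : Fock I) (n : ℕ) : (Fin n → ℝ) → ℂ :=
  ((Φ n : symL2 I n) : Lp ℂ 2 (cubeMeasure I n))

/-- Vectors with finitely many nonzero particle sectors. -/
def FiniteParticle {I : Set ℝ} (Φ : Fock I) : Prop :=
  ∃ n₀ : ℕ, ∀ n, n₀ ≤ n → Φ n = 0

/-! ### Path-ordered exponentials -/

variable {ι : Type} [Fintype ι] [DecidableEq ι]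

/-- The `n`-th Dyson term `∫_{t₁ < ⋯ < tₙ, tᵢ ∈ s} Q(t₁)⋯Q(tₙ)`, as an iterated (entrywise)
integral. -/
def dysonTerm (Q : ℝ → Matrix ι ι ℂ) : ℕ → Set ℝ → Matrix ι ι ℂ
  | 0, _ => 1
  | n + 1, s => Matrix.of fun a b => ∫ t in s, (dysonTerm Q n (s ∩ Set.Iio t) * Q t) a b

/-- The path-ordered exponential `𝒫 exp ∫_s Q`; factors at smaller positions stand to the left. -/
def propagator (Q : ℝ → Matrix ι ι ℂ) (s : Set ℝ) : Matrix ι ι ℂ :=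
  Matrix.of fun a b => ∑' n : ℕ, dysonTerm Q n s a b

/-- For `x₀ < ⋯ < x_{n-1}` in `I`, the `k`-th of the `n + 1` intervals into which these points
divide `I`: `{t ∈ I | x_{k-1} < t < x_k}`, without the lower bound if `k = 0` and
without the upper bound if `k = n`. -/
def gap (I : Set ℝ) {n : ℕ} (x : Fin n → ℝ) (k : Fin (n + 1)) : Set ℝ :=
  {t | t ∈ I ∧ ∀ i : Fin n, (i.castSucc < k → x i < t) ∧ (k ≤ i.castSucc → t < x i)}

/-- The matrix-product coefficient
`Tr (B V_-^1 K₁(x₁) V_1^2 K₂(x₂) ⋯ Kₙ(xₙ) V_n^+)` at `x₁ < ⋯ < xₙ`. -/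
def pathCoeff (I : Set ℝ) (B : Matrix ι ι ℂ) (Q : ℝ → Matrix ι ι ℂ) {n : ℕ}
    (K : Fin n → ℝ → Matrix ι ι ℂ) (x : Fin n → ℝ) : ℂ :=
  (B * propagator Q (gap I x 0) *
    (List.ofFn fun i : Fin n => K i (x i) * propagator Q (gap I x i.succ)).prod).trace

/-! ### Continuous matrix product states -/

/-- Tensors of a cMPS on `I` with bond space `ℂ^ι`. -/
structure CMPSTensors (I : Set ℝ) (ι : Type) where
  B : Matrix ι ι ℂ
  Q : ℝ → Matrix ι ι ℂ
  L : ℝ → Matrix ι ι ℂ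
  integrable_Q : ∀ a b, Integrable (fun x => Q x a b) (volume.restrict I)
  measurable_L : ∀ a b, AEStronglyMeasurable (fun x => L x a b) (volume.restrict I)

/-- `ψ` is the cMPS
`∑ₙ ∫_{x₁ < ⋯ < xₙ} Tr (B V_-^1 L(x₁) V_1^2 ⋯ L(xₙ) V_n^+) ψ†(x₁)⋯ψ†(xₙ)|Ω⟩`:
its normalised symmetric `n`-particle wave function at `x` is `(n!)^(-1/2)` times the coefficient
at the increasing rearrangement of `x`. -/
def CMPSTensors.IsState {I : Set ℝ} (A : CMPSTensors I ι) (ψ : Fock I) : Prop :=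
  ∀ n : ℕ, wave ψ n =ᵐ[cubeMeasure I n] fun x =>
    ((Real.sqrt (n.factorial : ℝ) : ℝ) : ℂ)⁻¹ *
      pathCoeff I A.B A.Q (fun _ : Fin n => A.L) (x ∘ Tuple.sort x)

/-! ### Continuous matrix product operators -/

/-- The supermaps `l_x = ψ†(x)[·]`, `r_x = [·]ψ(x)`, `Ad_x = ψ†(x)[·]ψ(x)`. -/
inductive Ladder : Type
  | l | r | ad
  deriving DecidableEq

/-- Tensors of a cMPO on `I` with bond space `ℂ^ι`. -/
structure CMPOTensors (I : Set ℝ) (ι : Type) where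
  B : Matrix ι ι ℂ
  Q : ℝ → Matrix ι ι ℂ
  L : ℝ → Matrix ι ι ℂ
  R : ℝ → Matrix ι ι ℂ
  T : ℝ → Matrix ι ι ℂ
  integrable_Q : ∀ a b, Integrable (fun x => Q x a b) (volume.restrict I)
  measurable_L : ∀ a b, AEStronglyMeasurable (fun x => L x a b) (volume.restrict I)
  measurable_R : ∀ a b, AEStronglyMeasurable (fun x => R x a b) (volume.restrict I)
  measurable_T : ∀ a b, AEStronglyMeasurable (fun x => T x a b) (volume.restrict I)

/-- The ordered configurations `x₁ < ⋯ < x_N` of points of `I`. -/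
def simplex (I : Set ℝ) (N : ℕ) : Set (Fin N → ℝ) :=
  {x | (∀ i, x i ∈ I) ∧ StrictMono x}

/-- The places of a word of supermaps that put a `ψ†` to the left of `|Ω⟩⟨Ω|`. -/
def leftPlaces {N : ℕ} (w : Fin N → Ladder) : Finset (Fin N) :=
  Finset.univ.filter fun k => w k ≠ Ladder.r

/-- The places of a word of supermaps that put a `ψ` to the right of `|Ω⟩⟨Ω|`. -/
def rightPlaces {N : ℕ} (w : Fin N → Ladder) : Finset (Fin N) :=
  Finset.univ.filter fun k => w k ≠ Ladder.l

/-- The sub-configuration of `x` at the places `S`, in increasing order. -/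
def subConfig {N : ℕ} (S : Finset (Fin N)) (x : Fin N → ℝ) : Fin S.card → ℝ :=
  fun i => x (S.orderEmbOfFin rfl i)

/-- `⟨Ω| ψ(x₁)⋯ψ(xₙ) |Φ⟩ = (n!)^(1/2) Φₙ(x₁,…,xₙ)`. -/
def amplitude {I : Set ℝ} (Φ : Fock I) {n : ℕ} (x : Fin n → ℝ) : ℂ :=
  ((Real.sqrt (n.factorial : ℝ) : ℝ) : ℂ) * wave Φ n x

namespace CMPOTensors

variable {I : Set ℝ} {κ : Type} [Fintype κ] [DecidableEq κ]

/-- The tensor that accompanies a supermap in the generator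
`𝔏_x = Q ⊗ Id + L ⊗ l_x + R ⊗ r_x + T ⊗ Ad_x`. -/
def tensor (S : CMPOTensors I ι) : Ladder → ℝ → Matrix ι ι ℂ
  | Ladder.l => S.L
  | Ladder.r => S.R
  | Ladder.ad => S.T

/-- The matrix element between `Φ` and `Ψ` of the term
`Tr (B V_-^1 K₁(x₁) V_1^2 ⋯ K_N(x_N) V_N^+) ⊗ f₁ ⋯ f_N [|Ω⟩⟨Ω|]`
that belongs to the word `f₁ ⋯ f_N = w` of supermaps at the positions `x₁ < ⋯ < x_N`. -/
def integrand (S : CMPOTensors I ι) (Φ Ψ : Fock I) {N : ℕ} (w : Fin N → Ladder)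
    (x : Fin N → ℝ) : ℂ :=
  pathCoeff I S.B S.Q (fun i => S.tensor (w i)) x *
    (star (amplitude Φ (subConfig (leftPlaces w) x)) *
      amplitude Ψ (subConfig (rightPlaces w) x))

/-- The bounded operator `O` on Fock space is the cMPO
`Tr (B 𝒫 exp ∫ 𝔏_x) (|Ω⟩⟨Ω|)`: its matrix elements between vectors of finite particle number
are given by the Dyson series in `l_x`, `r_x`, `Ad_x`, which is a sum over words of supermaps of
absolutely convergent integrals over ordered configurations. -/
def Represents (S : CMPOTensors I ι) (O : Fock I →L[ℂ] Fock I) : Prop :=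
  ∀ Φ Ψ : Fock I, FiniteParticle Φ → FiniteParticle Ψ →
    (∀ (N : ℕ) (w : Fin N → Ladder), IntegrableOn (S.integrand Φ Ψ w) (simplex I N)) ∧
    HasSum (fun W : Σ N : ℕ, (Fin N → Ladder) =>
      ∫ x in simplex I W.1, S.integrand Φ Ψ W.2 x) ⟪Φ, O Ψ⟫_ℂ

/-- The tensors `B = T = 1`, `Q = L = R = 0` of bond dimension one. -/
def identity (I : Set ℝ) : CMPOTensors I Unit where
  B := 1
  Q := 0
  L := 0
  R := 0
  T := fun _ => 1
  integrable_Q _ _ := integrable_zero _ _ _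
  measurable_L _ _ := aestronglyMeasurable_const
  measurable_R _ _ := aestronglyMeasurable_const
  measurable_T _ _ := aestronglyMeasurable_const

/-- The tensors of the projector onto a cMPS: `B ⊗ B*`, `Q ⊗ 1 + 1 ⊗ Q*`, `L ⊗ 1`, `1 ⊗ L*`, `0`
for `B, Q, L, R, T`, where `*` is the entrywise complex conjugate. -/
def projector (A : CMPSTensors I ι) : CMPOTensors I (ι × ι) where
  B := A.B ⊗ₖ A.B.map star
  Q := fun x => A.Q x ⊗ₖ 1 + 1 ⊗ₖ (A.Q x).map star
  L := fun x => A.L x ⊗ₖ 1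
  R := fun x => 1 ⊗ₖ (A.L x).map star
  T := 0
  integrable_Q a b := by
    simp only [Matrix.add_apply, Matrix.kroneckerMap_apply, Matrix.map_apply]
    refine ((A.integrable_Q a.1 b.1).mul_const _).add (Integrable.const_mul ?_ _)
    exact (ContinuousLinearMap.integrable_comp (Complex.conjCLE : ℂ →L[ℝ] ℂ)
      (A.integrable_Q a.2 b.2))
  measurable_L a b := by
    simp only [Matrix.kroneckerMap_apply]
    exact (A.measurable_L a.1 b.1).mul_const _
  measurable_R a b := by
    simp only [Matrix.kroneckerMap_apply, Matrix.map_apply]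
    exact (Complex.continuous_conj.comp_aestronglyMeasurable
      (A.measurable_L a.2 b.2)).const_mul _
  measurable_T _ _ := aestronglyMeasurable_const

/-- Multiplication of the boundary matrix, hence of the operator, by a scalar. -/
def scale (c : ℂ) (S : CMPOTensors I ι) : CMPOTensors I ι where
  B := c • S.B
  Q := S.Q
  L := S.L
  R := S.R
  T := S.T
  integrable_Q := S.integrable_Q
  measurable_L := S.measurable_L
  measurable_R := S.measurable_R
  measurable_T := S.measurable_T

/-- Direct sum of two systems of tensors. -/
def oplus (S : CMPOTensors I ι) (S' : CMPOTensors I κ) : CMPOTensors I (ι ⊕ κ) where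
  B := Matrix.fromBlocks S.B 0 0 S'.B
  Q := fun x => Matrix.fromBlocks (S.Q x) 0 0 (S'.Q x)
  L := fun x => Matrix.fromBlocks (S.L x) 0 0 (S'.L x)
  R := fun x => Matrix.fromBlocks (S.R x) 0 0 (S'.R x)
  T := fun x => Matrix.fromBlocks (S.T x) 0 0 (S'.T x)
  integrable_Q a b := by
    rcases a with a | a <;> rcases b with b | b <;>
      simp [S.integrable_Q, S'.integrable_Q]
  measurable_L a b := by
    rcases a with a | a <;> rcases b with b | b <;>
      simp [S.measurable_L, S'.measurable_L, aestronglyMeasurable_const]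
  measurable_R a b := by
    rcases a with a | a <;> rcases b with b | b <;>
      simp [S.measurable_R, S'.measurable_R, aestronglyMeasurable_const]
  measurable_T a b := by
    rcases a with a | a <;> rcases b with b | b <;>
      simp [S.measurable_T, S'.measurable_T, aestronglyMeasurable_const]

/-- Direct sum of a finite family of systems of tensors. -/
def directSum {m : ℕ} {ν : Fin m → Type} (S : ∀ j, CMPOTensors I (ν j)) :
    CMPOTensors I (Σ j, ν j) where
  B := Matrix.blockDiagonal' fun j => (S j).B
  Q := fun x => Matrix.blockDiagonal' fun j => (S j).Q x
  L := fun x => Matrix.blockDiagonal' fun j => (S j).L x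
  R := fun x => Matrix.blockDiagonal' fun j => (S j).R x
  T := fun x => Matrix.blockDiagonal' fun j => (S j).T x
  integrable_Q := by
    rintro ⟨i, a⟩ ⟨j, b⟩
    by_cases h : i = j
    · subst h
      simpa [Matrix.blockDiagonal'_apply] using (S i).integrable_Q a b
    · simp [Matrix.blockDiagonal'_apply, h]
  measurable_L := by
    rintro ⟨i, a⟩ ⟨j, b⟩
    by_cases h : i = j
    · subst h
      simpa [Matrix.blockDiagonal'_apply] using (S i).measurable_L a b
    · simp [Matrix.blockDiagonal'_apply, h, aestronglyMeasurable_const]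
  measurable_R := by
    rintro ⟨i, a⟩ ⟨j, b⟩
    by_cases h : i = j
    · subst h
      simpa [Matrix.blockDiagonal'_apply] using (S i).measurable_R a b
    · simp [Matrix.blockDiagonal'_apply, h, aestronglyMeasurable_const]
  measurable_T := by
    rintro ⟨i, a⟩ ⟨j, b⟩
    by_cases h : i = j
    · subst h
      simpa [Matrix.blockDiagonal'_apply] using (S i).measurable_T a b
    · simp [Matrix.blockDiagonal'_apply, h, aestronglyMeasurable_const]

end CMPOTensors

/-- `U` is a cMPU with bond dimension `D`: a unitary operator on Fock space that is a cMPO with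
tensors in `M_D(ℂ)`. -/
def IsCMPU {I : Set ℝ} (D : ℕ) (U : Fock I →L[ℂ] Fock I) : Prop :=
  U ∈ unitary (Fock I →L[ℂ] Fock I) ∧ ∃ S : CMPOTensors I (Fin D), S.Represents U

/-- The rank-one projector `|ψ⟩⟨ψ|` (for a unit vector `ψ`). -/
def proj {I : Set ℝ} (ψ : Fock I) : Fock I →L[ℂ] Fock I :=
  InnerProductSpace.rankOne ℂ ψ ψ

/-- `1 + ∑ⱼ (e^{i aⱼ} - 1) |ψⱼ⟩⟨ψⱼ|`. -/
def phaseRotation {I : Set ℝ} {m : ℕ} (ψ : Fin m → Fock I) (a : Fin m → ℝ) :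
    Fock I →L[ℂ] Fock I :=
  1 + ∑ j, (Complex.exp (Complex.I * (a j : ℂ)) - 1) • proj (ψ j)

end CMPO

end

noncomputable section

namespace CMPO

/-! ### Indefinite integrals and the integrated product rule. -/

section Primitive

variable {𝕜 : Type*} [RCLike 𝕜] {μ : Measure ℝ}

/-! Unitarity is elementary: the `P_j` are mutually orthogonal projections, so `U` multiplies each
`ψ_j` by a phase and fixes the orthogonal complement of their span. For the tensors, block-diagonal
data never mix in products or integrals and traces add, so representation is compatible with scalars
and direct sums. This reduces everything to `1` and the `P_j`. For `1` only the words `Ad ⋯ Ad`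
survive, with coefficient 1, and they give the sector inner products.

For a projector, let `V` be the propagator of `Q`. A propagator is the unique bounded solution of a
Volterra equation (`IsEvolution.unique`), and such equations multiply by the product rule
(`IsEvolution.mul_apply`). Hence the generator `Q ⊗ 1 + 1 ⊗ Q̄` has propagator `V ⊗ V̄`
(`propagator_kronecker`), propagators over adjacent sets compose (`propagator_union`), and they are
invertible (`propagator_mul_inv`). In the interaction picture (`pathCoeff_eq_dressed`) each factor
of the coefficient then depends on a single position; dressed `l` tensors act on the first Kronecker
factor only and dressed `r` tensors on the second. So the coefficient of a word is the cMPS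
coefficient at its left positions times the conjugate one at its right positions
(`pathCoeff_projector`).

Words with `n` letters `l` and `p` letters `r` are the shuffles of two ordered configurations, and
shuffles tile a product of simplices (`sum_shuffle_eq_mul`). Their sum is `⟪Φ n, ψ n⟫ * ⟪ψ p, Ψ p⟫`,
and the Cauchy product over `n + p = N` yields `⟪Φ, ψ⟫ * ⟪ψ, Ψ⟫`. Finite particle number leaves only
finitely many nonzero terms. -/

lemma norm_setIntegral_Iio_le {f : ℝ → 𝕜} (hf : Integrable f μ) (t : ℝ) :
    ‖∫ u in Set.Iio t, f u ∂μ‖ ≤ ∫ u, ‖f u‖ ∂μ :=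
  (norm_integral_le_integral_norm _).trans
    (setIntegral_le_integral hf.norm (.of_forall fun _ => norm_nonneg _))

lemma Integrable.bdd_continuous_mul {F f : ℝ → 𝕜} {C : ℝ} (hF : Continuous F)
    (hC : ∀ t, ‖F t‖ ≤ C) (hf : Integrable f μ) : Integrable (fun t => F t * f t) μ :=
  hf.bdd_mul hF.aestronglyMeasurable (.of_forall hC)

variable [NullSingletonClass μ]

/-- Dominated convergence: for each `u ≠ t₀` the cut-off integrand is locally constant in `t` near
`t₀`, and the point `t₀` is null. -/
lemma continuous_setIntegral_Iio {f : ℝ → 𝕜} (hf : Integrable f μ) :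
    Continuous fun t => ∫ u in Set.Iio t, f u ∂μ := by
  rw [continuous_iff_continuousAt]
  intro t₀
  simp_rw [← integral_indicator measurableSet_Iio]
  refine continuousAt_of_dominated (bound := fun u => ‖f u‖)
    (.of_forall fun t => hf.aestronglyMeasurable.indicator measurableSet_Iio)
    (.of_forall fun t => .of_forall fun u => norm_indicator_le_norm_self _ _) hf.norm ?_
  have h₀ : ∀ᵐ u ∂μ, u ≠ t₀ := compl_mem_ae_iff.2 (measure_singleton t₀)
  filter_upwards [h₀] with u hu
  refine ContinuousAt.congr (f := fun _ => (Set.Iio t₀).indicator f u) continuousAt_const ?_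
  rcases lt_or_gt_of_ne hu with h | h
  · filter_upwards [lt_mem_nhds h] with t ht
    simp [Set.indicator, h, ht]
  · filter_upwards [gt_mem_nhds h] with t ht
    simp [Set.indicator, h.not_gt, ht.not_gt]

/-- Fubini on the half-plane `x ≤ y`. This is integration by parts for merely integrable densities,
with no derivatives involved. -/
lemma integral_mul_integral_eq [SFinite μ] {f g : ℝ → 𝕜} (hf : Integrable f μ)
    (hg : Integrable g μ) :
    (∫ t, f t ∂μ) * ∫ t, g t ∂μ =
      ∫ t, ((∫ u in Set.Iio t, f u ∂μ) * g t + f t * ∫ u in Set.Iio t, g u ∂μ) ∂μ := by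
  have hS : MeasurableSet {p : ℝ × ℝ | p.1 ≤ p.2} := measurableSet_le measurable_fst measurable_snd
  have hint : Integrable (Function.uncurry fun x y => {p : ℝ × ℝ | p.1 ≤ p.2}.indicator
      (fun p => f p.1 * g p.2) (x, y)) (μ.prod μ) :=
    (hf.mul_prod hg).indicator hS
  have hswap := integral_integral_swap hint
  have h1 : ∀ x, ∫ y, {p : ℝ × ℝ | p.1 ≤ p.2}.indicator (fun p => f p.1 * g p.2) (x, y) ∂μ =
      f x * ∫ y in Set.Ici x, g y ∂μ := by
    intro x
    rw [← integral_indicator measurableSet_Ici, ← integral_const_mul]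
    refine integral_congr_ae (.of_forall fun y => ?_)
    by_cases h : x ≤ y <;> simp [Set.indicator, h]
  have h2 : ∀ y, ∫ x, {p : ℝ × ℝ | p.1 ≤ p.2}.indicator (fun p => f p.1 * g p.2) (x, y) ∂μ =
      (∫ x in Set.Iio y, f x ∂μ) * g y := by
    intro y
    rw [setIntegral_congr_set (Iio_ae_eq_Iic (μ := μ) (a := y)),
      ← integral_indicator measurableSet_Iic, ← integral_mul_const]
    refine integral_congr_ae (.of_forall fun x => ?_)
    by_cases h : x ≤ y <;> simp [Set.indicator, h]
  simp only [h1, h2] at hswap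
  have hi1 : Integrable (fun t => (∫ u in Set.Iio t, f u ∂μ) * g t) μ :=
    Integrable.bdd_continuous_mul (continuous_setIntegral_Iio hf) (norm_setIntegral_Iio_le hf) hg
  have hi2 : Integrable (fun t => f t * ∫ u in Set.Iio t, g u ∂μ) μ := by
    simpa only [mul_comm] using
      Integrable.bdd_continuous_mul (continuous_setIntegral_Iio hg) (norm_setIntegral_Iio_le hg) hf
  have hsplit : ∀ t, ∫ u in Set.Ici t, g u ∂μ = ∫ u, g u ∂μ - ∫ u in Set.Iio t, g u ∂μ := by
    intro t
    rw [eq_sub_iff_add_eq', ← Set.compl_Iio]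
    exact integral_add_compl measurableSet_Iio hg
  rw [integral_add hi1 hi2, ← hswap]
  simp_rw [hsplit, mul_sub]
  rw [integral_sub (hf.mul_const _) hi2, integral_mul_const]
  ring

lemma add_integral_mul_add_integral_eq [SFinite μ] {f g : ℝ → 𝕜} (hf : Integrable f μ)
    (hg : Integrable g μ) (α β : 𝕜) :
    (α + ∫ t, f t ∂μ) * (β + ∫ t, g t ∂μ) = α * β +
      ∫ t, ((α + ∫ u in Set.Iio t, f u ∂μ) * g t +
        f t * (β + ∫ u in Set.Iio t, g u ∂μ)) ∂μ := by
  have hi1 : Integrable (fun t => (∫ u in Set.Iio t, f u ∂μ) * g t) μ :=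
    Integrable.bdd_continuous_mul (continuous_setIntegral_Iio hf) (norm_setIntegral_Iio_le hf) hg
  have hi2 : Integrable (fun t => f t * ∫ u in Set.Iio t, g u ∂μ) μ := by
    simpa only [mul_comm] using
      Integrable.bdd_continuous_mul (continuous_setIntegral_Iio hg) (norm_setIntegral_Iio_le hg) hf
  have e : ∀ t, (α + ∫ u in Set.Iio t, f u ∂μ) * g t + f t * (β + ∫ u in Set.Iio t, g u ∂μ) =
      (α * g t + β * f t) + ((∫ u in Set.Iio t, f u ∂μ) * g t +
        f t * ∫ u in Set.Iio t, g u ∂μ) := fun t => by ring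
  simp_rw [e]
  have hα : Integrable (fun t => α * g t) μ := hg.const_mul α
  have hβ : Integrable (fun t => β * f t) μ := hf.const_mul β
  have hi : Integrable (fun t => (∫ u in Set.Iio t, f u ∂μ) * g t +
      f t * ∫ u in Set.Iio t, g u ∂μ) μ := hi1.add hi2
  rw [integral_add (f := fun t => α * g t + β * f t) (hα.add hβ) hi,
    ← integral_mul_integral_eq hf hg, integral_add hα hβ, integral_const_mul, integral_const_mul]
  ring

end Primitive

lemma inter_Iio_inter_Iio (r : Set ℝ) {u t : ℝ} (h : u < t) :
    r ∩ Set.Iio t ∩ Set.Iio u = r ∩ Set.Iio u := by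
  rw [Set.inter_assoc, Set.Iio_inter_Iio, min_eq_right h.le]

lemma continuous_setIntegral_inter_Iio {𝕜 : Type*} [RCLike 𝕜] {r : Set ℝ} {f : ℝ → 𝕜}
    (hf : IntegrableOn f r) : Continuous fun t => ∫ u in r ∩ Set.Iio t, f u := by
  simpa only [Set.inter_comm r, ← Measure.restrict_restrict measurableSet_Iio] using
    continuous_setIntegral_Iio hf

lemma integrableOn_pow_div_factorial {q : ℝ → ℝ} {r : Set ℝ} (hq : IntegrableOn q r) (n : ℕ) :
    IntegrableOn (fun t => (∫ u in r ∩ Set.Iio t, q u) ^ n / (n.factorial : ℝ) * q t) r := by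
  have hc := continuous_setIntegral_inter_Iio hq
  refine Integrable.bdd_continuous_mul (C := (∫ u in r, ‖q u‖) ^ n / (n.factorial : ℝ))
    (by fun_prop) (fun t => ?_) hq
  rw [norm_div, norm_pow, Real.norm_natCast, Set.inter_comm,
    ← Measure.restrict_restrict measurableSet_Iio]
  gcongr
  exact norm_setIntegral_Iio_le hq t

/-- `(∫_r q)ⁿ / n!` obeys the recursion of the Dyson terms. -/
lemma integral_pow_div_factorial {q : ℝ → ℝ} {r : Set ℝ} (hr : MeasurableSet r)
    (hq : IntegrableOn q r) (n : ℕ) :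
    ∫ t in r, (∫ u in r ∩ Set.Iio t, q u) ^ n / (n.factorial : ℝ) * q t =
      (∫ u in r, q u) ^ (n + 1) / ((n + 1).factorial : ℝ) := by
  induction n generalizing r with
  | zero => simp
  | succ n ih =>
    have key := add_integral_mul_add_integral_eq hq (integrableOn_pow_div_factorial hq n) 0 0
    simp only [zero_add, zero_mul, Measure.restrict_restrict measurableSet_Iio,
      Set.inter_comm _ r] at key
    have hin : ∀ t, ∫ u in r ∩ Set.Iio t,
        (∫ v in r ∩ Set.Iio u, q v) ^ n / (n.factorial : ℝ) * q u =
        (∫ u in r ∩ Set.Iio t, q u) ^ (n + 1) / ((n + 1).factorial : ℝ) := by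
      intro t
      rw [← ih (hr.inter measurableSet_Iio) (hq.mono_set Set.inter_subset_left)]
      refine setIntegral_congr_fun (hr.inter measurableSet_Iio) fun u hu => ?_
      simp only [inter_Iio_inter_Iio r hu.2]
    rw [ih hr hq] at key
    simp only [hin] at key
    -- The two halves of the product rule carry the weights `n + 1` and `1`; dividing by their sum
    -- `n + 2` produces the next factorial.
    have e : ∀ t, (∫ u in r ∩ Set.Iio t, q u) *
          ((∫ u in r ∩ Set.Iio t, q u) ^ n / (n.factorial : ℝ) * q t) +
        q t * ((∫ u in r ∩ Set.Iio t, q u) ^ (n + 1) / ((n + 1).factorial : ℝ)) =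
        (n + 2 : ℝ) * ((∫ u in r ∩ Set.Iio t, q u) ^ (n + 1) / ((n + 1).factorial : ℝ) * q t) := by
      intro t
      rw [Nat.factorial_succ]
      push_cast
      field_simp
      ring
    simp only [e, integral_const_mul] at key
    have h2 : (n + 2 : ℝ) ≠ 0 := by positivity
    rw [← mul_right_inj' h2, ← key, Nat.factorial_succ (n + 1)]
    push_cast
    field_simp
    ring

/-! ### Volterra equations and convergence of the Dyson series. -/

section Evolution

variable {ι : Type} [Fintype ι]

/-- The sum of the moduli of the entries. -/
def entrySum (Q : ℝ → Matrix ι ι ℂ) (t : ℝ) : ℝ := ∑ a, ∑ b, ‖Q t a b‖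

lemma entrySum_nonneg (Q : ℝ → Matrix ι ι ℂ) (t : ℝ) : 0 ≤ entrySum Q t := by
  unfold entrySum; positivity

lemma integrableOn_entrySum {Q : ℝ → Matrix ι ι ℂ} {s : Set ℝ}
    (hQ : ∀ a b, IntegrableOn (fun t => Q t a b) s) : IntegrableOn (entrySum Q) s :=
  integrable_finsetSum _ fun a _ => integrable_finsetSum _ fun b _ => (hQ a b).norm

/-- Using the sum over all entries makes the bound independent of `a, b`, so matrix estimates follow
the scalar recursion of `integral_pow_div_factorial`. -/
lemma norm_mul_apply_le {X : Matrix ι ι ℂ} {C : ℝ} (hX : ∀ a b, ‖X a b‖ ≤ C)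
    (Q : ℝ → Matrix ι ι ℂ) (t : ℝ) (a b : ι) : ‖(X * Q t) a b‖ ≤ C * entrySum Q t := by
  have hC : 0 ≤ C := (norm_nonneg _).trans (hX a a)
  rw [Matrix.mul_apply, entrySum, Finset.mul_sum]
  refine (norm_sum_le _ _).trans (Finset.sum_le_sum fun c _ => ?_)
  rw [norm_mul]
  gcongr
  · exact hX a c
  · exact Finset.single_le_sum (f := fun b => ‖Q t c b‖) (fun _ _ => norm_nonneg _)
      (Finset.mem_univ b)

lemma integrableOn_mul_apply {X : ℝ → Matrix ι ι ℂ} {Q : ℝ → Matrix ι ι ℂ} {s : Set ℝ} {C : ℝ}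
    (hc : ∀ a b, Continuous fun t => X t a b) (hX : ∀ t a b, ‖X t a b‖ ≤ C)
    (hQ : ∀ a b, IntegrableOn (fun t => Q t a b) s) (a b : ι) :
    IntegrableOn (fun t => (X t * Q t) a b) s := by
  simp only [Matrix.mul_apply]
  exact integrable_finsetSum _ fun c _ =>
    Integrable.bdd_continuous_mul (hc a c) (fun t => hX t a c) (hQ c b)

variable [DecidableEq ι]

/-- `X` solves `X r = 1 + ∫_r X (r ∩ Iio t) Q t` for the measurable `r ⊆ s`. -/
structure IsEvolution (Q : ℝ → Matrix ι ι ℂ) (s : Set ℝ) (X : Set ℝ → Matrix ι ι ℂ) : Prop where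
  continuous : ∀ r, MeasurableSet r → r ⊆ s → ∀ a b, Continuous fun t => X (r ∩ Set.Iio t) a b
  bounded : ∃ C, ∀ r, MeasurableSet r → r ⊆ s → ∀ a b, ‖X r a b‖ ≤ C
  eqn : ∀ r, MeasurableSet r → r ⊆ s → ∀ a b,
    X r a b = (1 : Matrix ι ι ℂ) a b + ∫ t in r, (X (r ∩ Set.Iio t) * Q t) a b

namespace IsEvolution

variable {κ : Type} [Fintype κ] [DecidableEq κ]
  {Q : ℝ → Matrix ι ι ℂ} {s : Set ℝ} {X Y : Set ℝ → Matrix ι ι ℂ}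
  {Q' : ℝ → Matrix κ κ ℂ} {X' : Set ℝ → Matrix κ κ ℂ}

lemma integrableOn (hX : IsEvolution Q s X) (hQ : ∀ a b, IntegrableOn (fun t => Q t a b) s)
    {r : Set ℝ} (hr : MeasurableSet r) (hrs : r ⊆ s) (a b : ι) :
    IntegrableOn (fun t => (X (r ∩ Set.Iio t) * Q t) a b) r := by
  obtain ⟨C, hC⟩ := hX.bounded
  exact integrableOn_mul_apply (hX.continuous r hr hrs)
    (fun t => hC _ (hr.inter measurableSet_Iio) (Set.inter_subset_left.trans hrs))
    (fun a b => (hQ a b).mono_set hrs) a b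

/-- The difference solves the homogeneous equation; iterating it on the truncated sets `r ∩ Iio t`
bounds it by a constant times `(∫ q)ⁿ / n!`, which tends to 0. -/
lemma unique (hX : IsEvolution Q s X) (hY : IsEvolution Q s Y)
    (hQ : ∀ a b, IntegrableOn (fun t => Q t a b) s) {r : Set ℝ} (hr : MeasurableSet r)
    (hrs : r ⊆ s) : X r = Y r := by
  obtain ⟨C, hC⟩ := hX.bounded
  obtain ⟨C', hC'⟩ := hY.bounded
  have hq := integrableOn_entrySum hQ
  have bound : ∀ n : ℕ, ∀ r, MeasurableSet r → r ⊆ s → ∀ a b, ‖(X r - Y r) a b‖ ≤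
      (C + C') * ((∫ t in r, entrySum Q t) ^ n / (n.factorial : ℝ)) := by
    intro n
    induction n with
    | zero =>
      intro r hr hrs a b
      simpa using (norm_sub_le _ _).trans (add_le_add (hC r hr hrs a b) (hC' r hr hrs a b))
    | succ n ih =>
      intro r hr hrs a b
      rw [Matrix.sub_apply, hX.eqn r hr hrs, hY.eqn r hr hrs, add_sub_add_left_eq_sub,
        ← integral_sub (hX.integrableOn hQ hr hrs a b) (hY.integrableOn hQ hr hrs a b)]
      simp only [← Matrix.sub_apply, ← Matrix.sub_mul]
      rw [← integral_pow_div_factorial hr (hq.mono_set hrs), ← integral_const_mul]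
      refine norm_integral_le_of_norm_le
        ((integrableOn_pow_div_factorial (hq.mono_set hrs) n).const_mul _) (.of_forall fun t => ?_)
      rw [← mul_assoc]
      exact norm_mul_apply_le (ih _ (hr.inter measurableSet_Iio)
        (Set.inter_subset_left.trans hrs)) Q t a b
  ext a b
  have hlim : Filter.Tendsto (fun n : ℕ =>
      (C + C') * ((∫ t in r, entrySum Q t) ^ n / (n.factorial : ℝ))) Filter.atTop (nhds 0) := by
    simpa using (FloorSemiring.tendsto_pow_div_factorial_atTop
      (∫ t in r, entrySum Q t)).const_mul (C + C')
  have := ge_of_tendsto' hlim fun n => bound n r hr hrs a b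
  exact sub_eq_zero.1 (norm_le_zero_iff.1 this)

lemma mul_apply (hX : IsEvolution Q s X) (hX' : IsEvolution Q' s X')
    (hQ : ∀ a b, IntegrableOn (fun t => Q t a b) s)
    (hQ' : ∀ a b, IntegrableOn (fun t => Q' t a b) s) {r : Set ℝ} (hr : MeasurableSet r)
    (hrs : r ⊆ s) (a b : ι) (c d : κ) :
    IntegrableOn (fun t => X (r ∩ Set.Iio t) a b * (X' (r ∩ Set.Iio t) * Q' t) c d +
      (X (r ∩ Set.Iio t) * Q t) a b * X' (r ∩ Set.Iio t) c d) r ∧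
    X r a b * X' r c d = (1 : Matrix ι ι ℂ) a b * (1 : Matrix κ κ ℂ) c d +
      ∫ t in r, (X (r ∩ Set.Iio t) a b * (X' (r ∩ Set.Iio t) * Q' t) c d +
        (X (r ∩ Set.Iio t) * Q t) a b * X' (r ∩ Set.Iio t) c d) := by
  have hi := hX.integrableOn hQ hr hrs a b
  have hi' := hX'.integrableOn hQ' hr hrs c d
  constructor
  · obtain ⟨C, hC⟩ := hX.bounded
    obtain ⟨C', hC'⟩ := hX'.bounded
    refine Integrable.add ?_ ?_
    · exact Integrable.bdd_continuous_mul (hX.continuous r hr hrs a b)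
        (fun t => hC _ (hr.inter measurableSet_Iio) (Set.inter_subset_left.trans hrs) a b) hi'
    · simpa only [mul_comm] using Integrable.bdd_continuous_mul (hX'.continuous r hr hrs c d)
        (fun t => hC' _ (hr.inter measurableSet_Iio) (Set.inter_subset_left.trans hrs) c d) hi
  · have key := add_integral_mul_add_integral_eq hi hi' ((1 : Matrix ι ι ℂ) a b)
      ((1 : Matrix κ κ ℂ) c d)
    rw [← hX.eqn r hr hrs, ← hX'.eqn r hr hrs] at key
    rw [key]
    congr 1
    refine integral_congr_ae (.of_forall fun t => ?_)
    -- The primitive cut at `t` is the evolution over `r ∩ Iio t`, because for `u < t` the two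
    -- successive cuts collapse into one.
    have e : (1 : Matrix ι ι ℂ) a b +
        ∫ u in Set.Iio t, (X (r ∩ Set.Iio u) * Q u) a b ∂(volume.restrict r) =
        X (r ∩ Set.Iio t) a b := by
      rw [hX.eqn _ (hr.inter measurableSet_Iio) (Set.inter_subset_left.trans hrs),
        Measure.restrict_restrict measurableSet_Iio, Set.inter_comm (Set.Iio t)]
      congr 1
      refine setIntegral_congr_fun (hr.inter measurableSet_Iio) fun u hu => ?_
      simp only [inter_Iio_inter_Iio r hu.2]
    have e' : (1 : Matrix κ κ ℂ) c d +
        ∫ u in Set.Iio t, (X' (r ∩ Set.Iio u) * Q' u) c d ∂(volume.restrict r) =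
        X' (r ∩ Set.Iio t) c d := by
      rw [hX'.eqn _ (hr.inter measurableSet_Iio) (Set.inter_subset_left.trans hrs),
        Measure.restrict_restrict measurableSet_Iio, Set.inter_comm (Set.Iio t)]
      congr 1
      refine setIntegral_congr_fun (hr.inter measurableSet_Iio) fun u hu => ?_
      simp only [inter_Iio_inter_Iio r hu.2]
    simp only [e, e']

end IsEvolution

lemma dysonTerm_succ_apply (Q : ℝ → Matrix ι ι ℂ) (n : ℕ) (s : Set ℝ) (a b : ι) :
    dysonTerm Q (n + 1) s a b = ∫ t in s, (dysonTerm Q n (s ∩ Set.Iio t) * Q t) a b := rfl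

section Dyson

variable {Q : ℝ → Matrix ι ι ℂ} {s : Set ℝ} (hQ : ∀ a b, IntegrableOn (fun t => Q t a b) s)
include hQ

lemma norm_dysonTerm_le (n : ℕ) {r : Set ℝ} (hr : MeasurableSet r) (hrs : r ⊆ s) (a b : ι) :
    ‖dysonTerm Q n r a b‖ ≤ (∫ t in r, entrySum Q t) ^ n / (n.factorial : ℝ) := by
  have hq := integrableOn_entrySum hQ
  induction n generalizing r a b with
  | zero => by_cases h : a = b <;> simp [dysonTerm, Matrix.one_apply, h]
  | succ n ih =>
    rw [dysonTerm_succ_apply, ← integral_pow_div_factorial hr (hq.mono_set hrs)]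
    refine norm_integral_le_of_norm_le (integrableOn_pow_div_factorial (hq.mono_set hrs) n)
      (.of_forall fun t => ?_)
    exact norm_mul_apply_le (fun a b => ih (hr.inter measurableSet_Iio)
        (Set.inter_subset_left.trans hrs) a b) Q t a b

omit [DecidableEq ι] in
lemma setIntegral_entrySum_le {r : Set ℝ} (hrs : r ⊆ s) :
    ∫ t in r, entrySum Q t ≤ ∫ t in s, entrySum Q t :=
  setIntegral_mono_set (integrableOn_entrySum hQ) (.of_forall fun t => entrySum_nonneg Q t)
    hrs.eventuallyLE

lemma norm_dysonTerm_le_of_subset (n : ℕ) {r : Set ℝ} (hr : MeasurableSet r) (hrs : r ⊆ s)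
    (a b : ι) : ‖dysonTerm Q n r a b‖ ≤ (∫ t in s, entrySum Q t) ^ n / (n.factorial : ℝ) := by
  refine (norm_dysonTerm_le hQ n hr hrs a b).trans ?_
  have h0 : 0 ≤ ∫ t in r, entrySum Q t := integral_nonneg fun t => entrySum_nonneg Q t
  exact div_le_div_of_nonneg_right (pow_le_pow_left₀ h0 (setIntegral_entrySum_le hQ hrs) n)
    (by positivity)

lemma continuous_dysonTerm (n : ℕ) {r : Set ℝ} (hr : MeasurableSet r) (hrs : r ⊆ s) (a b : ι) :
    Continuous fun t => dysonTerm Q n (r ∩ Set.Iio t) a b := by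
  induction n generalizing a b with
  | zero => simpa [dysonTerm] using continuous_const
  | succ n ih =>
    have hi : IntegrableOn (fun t => (dysonTerm Q n (r ∩ Set.Iio t) * Q t) a b) r :=
      integrableOn_mul_apply ih (fun t => norm_dysonTerm_le_of_subset hQ n
        (hr.inter measurableSet_Iio) (Set.inter_subset_left.trans hrs))
        (fun a b => (hQ a b).mono_set hrs) a b
    refine (continuous_setIntegral_inter_Iio hi).congr fun t => ?_
    rw [dysonTerm_succ_apply]
    refine setIntegral_congr_fun (hr.inter measurableSet_Iio) fun u hu => ?_
    simp only [inter_Iio_inter_Iio r hu.2]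

lemma summable_norm_dysonTerm {r : Set ℝ} (hr : MeasurableSet r) (hrs : r ⊆ s) (a b : ι) :
    Summable fun n => ‖dysonTerm Q n r a b‖ :=
  (Real.summable_pow_div_factorial (∫ t in s, entrySum Q t)).of_nonneg_of_le
    (fun _ => norm_nonneg _) fun n => norm_dysonTerm_le_of_subset hQ n hr hrs a b

/-- The equation is the Dyson series shifted by one index. Sum and integral are exchanged under the
factorial majorant, which is uniform over subsets of `s`. -/
lemma isEvolution_propagator : IsEvolution Q s (propagator Q) where
  continuous r hr hrs a b := continuous_tsum (fun n => continuous_dysonTerm hQ n hr hrs a b)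
    (Real.summable_pow_div_factorial (∫ t in s, entrySum Q t)) fun n t =>
      norm_dysonTerm_le_of_subset hQ n (hr.inter measurableSet_Iio)
        (Set.inter_subset_left.trans hrs) a b
  bounded := ⟨∑' n : ℕ, (∫ t in s, entrySum Q t) ^ n / (n.factorial : ℝ), fun r hr hrs a b =>
    tsum_of_norm_bounded (Real.summable_pow_div_factorial _).hasSum fun n =>
      norm_dysonTerm_le_of_subset hQ n hr hrs a b⟩
  eqn r hr hrs a b := by
    have hsum : ∀ r, MeasurableSet r → r ⊆ s → ∀ a b,
        HasSum (fun n => dysonTerm Q n r a b) (propagator Q r a b) := fun r hr hrs a b =>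
      (summable_norm_dysonTerm hQ hr hrs a b).of_norm.hasSum
    have h1 := (hasSum_nat_add_iff' 1).2 (hsum r hr hrs a b)
    rw [Finset.sum_range_one] at h1
    have hq := integrableOn_entrySum hQ
    have h2 : HasSum (fun n => dysonTerm Q (n + 1) r a b)
        (∫ t in r, (propagator Q (r ∩ Set.Iio t) * Q t) a b) := by
      refine hasSum_integral_of_dominated_convergence
        (fun n t => (∫ t in s, entrySum Q t) ^ n / (n.factorial : ℝ) * entrySum Q t) ?_ ?_ ?_ ?_ ?_
      · intro n
        exact (integrableOn_mul_apply (fun a b => continuous_dysonTerm hQ n hr hrs a b)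
          (fun t => norm_dysonTerm_le_of_subset hQ n
          (hr.inter measurableSet_Iio) (Set.inter_subset_left.trans hrs))
          (fun a b => (hQ a b).mono_set hrs) a b).aestronglyMeasurable
      · exact fun n => .of_forall fun t => norm_mul_apply_le (fun a b =>
          norm_dysonTerm_le_of_subset hQ n (hr.inter measurableSet_Iio)
          (Set.inter_subset_left.trans hrs) a b) Q t a b
      · exact .of_forall fun t => (Real.summable_pow_div_factorial _).mul_right _
      · simp_rw [tsum_mul_right]
        exact (hq.mono_set hrs).const_mul _
      · refine .of_forall fun t => ?_
        simp only [Matrix.mul_apply]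
        exact hasSum_sum fun c _ => (hsum _ (hr.inter measurableSet_Iio)
          (Set.inter_subset_left.trans hrs) a c).mul_right _
    have h3 := h1.unique h2
    rw [← h3]
    simp [dysonTerm]

end Dyson

end Evolution

/-! ### Algebra of propagators: Kronecker products, composition, inverses. -/

section Propagator

variable {ι : Type} [Fintype ι] [DecidableEq ι] {κ : Type} [Fintype κ] [DecidableEq κ]

lemma dysonTerm_congr_set (Q : ℝ → Matrix ι ι ℂ) (n : ℕ) {s s' : Set ℝ} (h : s =ᵐ[volume] s') :
    dysonTerm Q n s = dysonTerm Q n s' := by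
  induction n generalizing s s' with
  | zero => rfl
  | succ n ih =>
    ext a b
    rw [dysonTerm_succ_apply, dysonTerm_succ_apply, setIntegral_congr_set h]
    simp_rw [fun t => ih (h.inter (Filter.EventuallyEq.refl _ (Set.Iio t)))]

lemma propagator_congr_set (Q : ℝ → Matrix ι ι ℂ) {s s' : Set ℝ} (h : s =ᵐ[volume] s') :
    propagator Q s = propagator Q s' := by
  simp only [propagator, dysonTerm_congr_set Q _ h]

/-- Shrinking the domain amounts to switching `Q` off. This places propagators over different sets
on one common domain, where the product rule applies. -/
lemma dysonTerm_inter_eq_indicator (Q : ℝ → Matrix ι ι ℂ) (n : ℕ) (r : Set ℝ) {s : Set ℝ}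
    (hs : MeasurableSet s) : dysonTerm Q n (r ∩ s) = dysonTerm (s.indicator Q) n r := by
  induction n generalizing r with
  | zero => rfl
  | succ n ih =>
    ext a b
    rw [dysonTerm_succ_apply, dysonTerm_succ_apply, ← setIntegral_indicator hs]
    refine integral_congr_ae (.of_forall fun t => ?_)
    by_cases h : t ∈ s
    · simp [h, ← ih, Set.inter_right_comm r s]
    · simp [h]

lemma propagator_inter_eq_indicator (Q : ℝ → Matrix ι ι ℂ) (r : Set ℝ) {s : Set ℝ}
    (hs : MeasurableSet s) : propagator Q (r ∩ s) = propagator (s.indicator Q) r := by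
  simp only [propagator, dysonTerm_inter_eq_indicator Q _ r hs]

lemma dysonTerm_map_star (Q : ℝ → Matrix ι ι ℂ) (n : ℕ) (s : Set ℝ) :
    dysonTerm (fun t => (Q t).map star) n s = (dysonTerm Q n s).map star := by
  induction n generalizing s with
  | zero => ext a b; by_cases h : a = b <;> simp [dysonTerm, Matrix.one_apply, h]
  | succ n ih =>
    ext a b
    rw [dysonTerm_succ_apply, Matrix.map_apply, dysonTerm_succ_apply]
    refine Eq.trans ?_ integral_conj
    refine integral_congr_ae (.of_forall fun t => ?_)
    simp only [ih]
    simp [Matrix.mul_apply]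

lemma propagator_map_star (Q : ℝ → Matrix ι ι ℂ) (s : Set ℝ) :
    propagator (fun t => (Q t).map star) s = (propagator Q s).map star := by
  ext a b
  simp only [propagator, Matrix.of_apply, Matrix.map_apply, dysonTerm_map_star]
  exact (Complex.conj_tsum _).symm

lemma propagator_empty (Q : ℝ → Matrix ι ι ℂ) : propagator Q ∅ = 1 := by
  ext a b
  rw [propagator, Matrix.of_apply, tsum_eq_single 0]
  · simp [dysonTerm]
  · rintro (_ | n) h
    · exact absurd rfl h
    · simp [dysonTerm_succ_apply]

lemma propagator_zero (s : Set ℝ) : propagator (0 : ℝ → Matrix ι ι ℂ) s = 1 := by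
  ext a b
  rw [propagator, Matrix.of_apply, tsum_eq_single 0]
  · simp [dysonTerm]
  · rintro (_ | n) h
    · exact absurd rfl h
    · simp [dysonTerm_succ_apply]

lemma integrableOn_map_star {ι : Type} {Q : ℝ → Matrix ι ι ℂ} {s : Set ℝ}
    (hQ : ∀ a b, IntegrableOn (fun t => Q t a b) s) (a b : ι) :
    IntegrableOn (fun t => (Q t).map star a b) s :=
  ContinuousLinearMap.integrable_comp (Complex.conjCLE : ℂ →L[ℝ] ℂ) (hQ a b)

variable {Q : ℝ → Matrix ι ι ℂ} {s : Set ℝ}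

/-- By the product rule the right-hand side solves the Volterra equation of the left-hand generator;
uniqueness concludes. -/
lemma propagator_kronecker {Q' : ℝ → Matrix κ κ ℂ}
    (hQ : ∀ a b, IntegrableOn (fun t => Q t a b) s)
    (hQ' : ∀ a b, IntegrableOn (fun t => Q' t a b) s) (hs : MeasurableSet s) :
    propagator (fun t => Q t ⊗ₖ (1 : Matrix κ κ ℂ) + (1 : Matrix ι ι ℂ) ⊗ₖ Q' t) s =
      propagator Q s ⊗ₖ propagator Q' s := by
  have hQQ : ∀ a b, IntegrableOn
      (fun t => (Q t ⊗ₖ (1 : Matrix κ κ ℂ) + (1 : Matrix ι ι ℂ) ⊗ₖ Q' t) a b) s := fun a b => by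
    simp only [Matrix.add_apply, Matrix.kroneckerMap_apply]
    exact ((hQ a.1 b.1).mul_const _).add ((hQ' a.2 b.2).const_mul _)
  have hX := isEvolution_propagator hQ
  have hX' := isEvolution_propagator hQ'
  refine (isEvolution_propagator hQQ).unique (Y := fun r => propagator Q r ⊗ₖ propagator Q' r)
    ⟨?_, ?_, ?_⟩ hQQ hs subset_rfl
  · exact fun r hr hrs a b => (hX.continuous r hr hrs a.1 b.1).mul (hX'.continuous r hr hrs a.2 b.2)
  · obtain ⟨C, hC⟩ := hX.bounded
    obtain ⟨C', hC'⟩ := hX'.bounded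
    refine ⟨C * C', fun r hr hrs a b => ?_⟩
    rw [Matrix.kroneckerMap_apply, norm_mul]
    exact mul_le_mul (hC r hr hrs _ _) (hC' r hr hrs _ _) (norm_nonneg _)
      ((norm_nonneg _).trans (hC r hr hrs a.1 b.1))
  · intro r hr hrs a b
    rw [Matrix.kroneckerMap_apply, (hX.mul_apply hX' hQ hQ' hr hrs _ _ _ _).2,
      ← Matrix.one_kronecker_one, Matrix.kroneckerMap_apply]
    congr 1
    refine integral_congr_ae (.of_forall fun t => ?_)
    simp only [mul_add, ← Matrix.mul_kronecker_mul, mul_one, Matrix.add_apply,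
      Matrix.kroneckerMap_apply]
    ring

/-- The product of the evolutions with `Q` switched off outside `s₁` and outside `s₂` solves the
equation for `Q` itself, so uniqueness applies. -/
lemma propagator_union {s₁ s₂ : Set ℝ} (h₁ : MeasurableSet s₁) (h₂ : MeasurableSet s₂)
    (hlt : ∀ x ∈ s₁, ∀ y ∈ s₂, x < y)
    (hQ : ∀ a b, IntegrableOn (fun t => Q t a b) (s₁ ∪ s₂)) :
    propagator Q (s₁ ∪ s₂) = propagator Q s₁ * propagator Q s₂ := by
  have hQi : ∀ s', MeasurableSet s' → ∀ a b,
      IntegrableOn (fun t => s'.indicator Q t a b) (s₁ ∪ s₂) := fun s' hs' a b => by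
    refine ((hQ a b).indicator hs').congr (.of_forall fun t => ?_)
    by_cases h : t ∈ s' <;> simp [h]
  have hX := isEvolution_propagator (hQi s₁ h₁)
  have hX' := isEvolution_propagator (hQi s₂ h₂)
  have main := (isEvolution_propagator hQ).unique
    (Y := fun r => propagator (s₁.indicator Q) r * propagator (s₂.indicator Q) r)
    ⟨?_, ?_, ?_⟩ hQ (h₁.union h₂) subset_rfl
  · rw [main, ← propagator_inter_eq_indicator _ _ h₁, ← propagator_inter_eq_indicator _ _ h₂,
      Set.union_inter_cancel_left, Set.union_inter_cancel_right]
  · intro r hr hrs a b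
    simp only [Matrix.mul_apply]
    exact continuous_finsetSum _ fun c _ =>
      (hX.continuous r hr hrs a c).mul (hX'.continuous r hr hrs c b)
  · obtain ⟨C, hC⟩ := hX.bounded
    obtain ⟨C', hC'⟩ := hX'.bounded
    refine ⟨∑ _c : ι, C * C', fun r hr hrs a b => ?_⟩
    rw [Matrix.mul_apply]
    refine (norm_sum_le _ _).trans (Finset.sum_le_sum fun c _ => ?_)
    rw [norm_mul]
    exact mul_le_mul (hC r hr hrs _ _) (hC' r hr hrs _ _) (norm_nonneg _)
      ((norm_nonneg _).trans (hC r hr hrs a c))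
  · intro r hr hrs a b
    have hm := fun c => hX.mul_apply hX' (hQi s₁ h₁) (hQi s₂ h₂) hr hrs a c c b
    rw [Matrix.mul_apply, Finset.sum_congr rfl fun c _ => (hm c).2, Finset.sum_add_distrib,
      ← integral_finsetSum _ fun c _ => (hm c).1, ← Matrix.mul_apply, mul_one]
    congr 1
    refine setIntegral_congr_fun hr fun t ht => ?_
    simp only [Finset.sum_add_distrib, ← Matrix.mul_apply, ← Matrix.add_apply, Matrix.mul_assoc]
    -- For `t ∈ s₁` nothing of `s₂` lies below `t`, so the second factor is still `1` and `Q t` may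
    -- be moved past it. For `t ∈ s₂` it already stands on the right.
    by_cases h : t ∈ s₁
    · have h2 : t ∉ s₂ := fun h2 => lt_irrefl _ (hlt t h t h2)
      have h3 : r ∩ Set.Iio t ∩ s₂ = ∅ := by
        ext u
        simp only [Set.mem_inter_iff, Set.mem_Iio, Set.mem_empty_iff_false, iff_false]
        exact fun hu => lt_asymm hu.1.2 (hlt t h u hu.2)
      simp [h, h2, ← propagator_inter_eq_indicator Q _ h₂, h3, propagator_empty]
    · have h2 : t ∈ s₂ := (hrs ht).resolve_left h
      simp [h, h2]

/-- The inverse of the propagator. -/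
def propagatorInv (Q : ℝ → Matrix ι ι ℂ) (s : Set ℝ) : Matrix ι ι ℂ :=
  (propagator (fun t => -(Q t).transpose) s).transpose

/-- The inverse `Y` should satisfy `Y = 1 - ∫ Q Y`, with `Q` on the left; transposing gives an
evolution with generator `-Qᵀ`. The product rule for `V Y` then has integrand `V Q Y - V Q Y = 0`.
-/
lemma propagator_mul_inv (hQ : ∀ a b, IntegrableOn (fun t => Q t a b) s) (hs : MeasurableSet s) :
    propagator Q s * propagatorInv Q s = 1 := by
  have hQ' : ∀ a b, IntegrableOn (fun t => (-(Q t).transpose) a b) s := fun a b => (hQ b a).neg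
  have hX := isEvolution_propagator hQ
  have hX' := isEvolution_propagator hQ'
  ext a b
  have hm := fun c => hX.mul_apply hX' hQ hQ' hs subset_rfl a c b c
  rw [Matrix.mul_apply]
  simp only [propagatorInv, Matrix.transpose_apply]
  rw [Finset.sum_congr rfl fun c _ => (hm c).2, Finset.sum_add_distrib,
      ← integral_finsetSum _ fun c _ => (hm c).1]
  have h0 : ∀ t, ∑ c, (propagator Q (s ∩ Set.Iio t) a c *
      (propagator (fun t => -(Q t).transpose) (s ∩ Set.Iio t) * -(Q t).transpose) b c +
      (propagator Q (s ∩ Set.Iio t) * Q t) a c *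
        propagator (fun t => -(Q t).transpose) (s ∩ Set.Iio t) b c) = 0 := by
    intro t
    have e := congrFun (congrFun (Matrix.mul_assoc (propagator Q (s ∩ Set.Iio t)) (Q t)
      (propagator (fun t => -(Q t).transpose) (s ∩ Set.Iio t)).transpose) a) b
    rw [Matrix.mul_apply, Matrix.mul_apply] at e
    simp only [Matrix.transpose_apply] at e
    rw [Finset.sum_add_distrib, e, ← Finset.sum_add_distrib]
    refine Finset.sum_eq_zero fun c _ => ?_
    simp only [Matrix.mul_apply, Matrix.neg_apply, Matrix.transpose_apply, mul_neg,
      Finset.sum_neg_distrib, mul_comm (Q t c _), neg_add_cancel]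
  simp only [h0, integral_zero, add_zero]
  simp [Matrix.one_apply]

lemma propagatorInv_mul (hQ : ∀ a b, IntegrableOn (fun t => Q t a b) s) (hs : MeasurableSet s) :
    propagatorInv Q s * propagator Q s = 1 :=
  mul_eq_one_comm.1 (propagator_mul_inv hQ hs)

end Propagator

/-! ### Rearrangement of ordered products. -/

section ListProducts

variable {M : Type*} [Monoid M]

/-- Pure rebracketing: each `G` moves from the gap on its left to the tensor on its right. -/
lemma prod_ofFn_telescope {n : ℕ} (G : Fin (n + 1) → M) (K H : Fin n → M) :
    G 0 * (List.ofFn fun i : Fin n => K i * (H i * G i.succ)).prod =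
      (List.ofFn fun i : Fin n => G i.castSucc * K i * H i).prod * G (Fin.last n) := by
  induction n with
  | zero => simp
  | succ n ih =>
    have := ih (fun i => G i.succ) (fun i => K i.succ) (fun i => H i.succ)
    simp only [List.ofFn_succ, List.prod_cons, Fin.castSucc_zero, Fin.succ_zero_eq_one,
      Fin.succ_last, Fin.castSucc_succ, mul_assoc] at this ⊢
    rw [← this]

/-- Unit factors drop out, and two increasing lists with the same members coincide. This is how one
Kronecker factor sees only a sub-configuration. -/
lemma prod_ofFn_ite {n : ℕ} (S : Finset (Fin n)) (f : Fin n → M) :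
    (List.ofFn fun i => if i ∈ S then f i else 1).prod =
      (List.ofFn fun j => f (S.orderEmbOfFin rfl j)).prod := by
  have h1 : ∀ l : List (Fin n), (l.map fun i => if i ∈ S then f i else 1).prod =
      ((l.filter (· ∈ S)).map f).prod := by
    intro l
    induction l with
    | nil => simp
    | cons a l ih => by_cases h : a ∈ S <;> simp [h, ih]
  have h2 : (List.finRange n).filter (· ∈ S) = List.ofFn (S.orderEmbOfFin rfl) := by
    refine List.Perm.eq_of_pairwise (le := (· < ·)) (fun a b _ _ h h' => absurd h' h.asymm)
      ((List.pairwise_lt_finRange n).filter _)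
      (List.pairwise_ofFn.2 fun i j h => (S.orderEmbOfFin rfl).strictMono h) ?_
    rw [List.perm_ext_iff_of_nodup ((List.nodup_finRange n).filter _)
      (List.nodup_ofFn.2 (S.orderEmbOfFin rfl).injective)]
    intro a
    rw [List.mem_filter, List.mem_ofFn, ← Set.mem_range, S.range_orderEmbOfFin rfl]
    simp
  rw [List.ofFn_eq_map, h1, h2, List.map_ofFn]
  rfl

lemma prod_ofFn_kronecker {ι κ : Type*} [Fintype ι] [DecidableEq ι] [Fintype κ] [DecidableEq κ]
    {n : ℕ} (A : Fin n → Matrix ι ι ℂ) (C : Fin n → Matrix κ κ ℂ) :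
    (List.ofFn fun i => A i ⊗ₖ C i).prod = (List.ofFn A).prod ⊗ₖ (List.ofFn C).prod := by
  induction n with
  | zero => simp
  | succ n ih => simp [List.ofFn_succ, ih, Matrix.mul_kronecker_mul]

end ListProducts

/-! ### Path coefficients in the interaction picture. -/

section PathCoeff

variable {ι : Type} [Fintype ι] [DecidableEq ι] {I : Set ℝ}

lemma measurableSet_gap (hI : MeasurableSet I) {n : ℕ} (x : Fin n → ℝ) (k : Fin (n + 1)) :
    MeasurableSet (gap I x k) := by
  have e : gap I x k = I ∩ ⋂ i : Fin n,
      ({t | i.castSucc < k → x i < t} ∩ {t | k ≤ i.castSucc → t < x i}) := by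
    ext t; simp [gap]
  rw [e]
  refine hI.inter ?_
  refine MeasurableSet.iInter fun i => MeasurableSet.inter ?_ ?_
  · by_cases h : i.castSucc < k
    · simpa only [h, forall_const] using! (measurableSet_Ioi : MeasurableSet (Set.Ioi (x i)))
    · simp [h]
  · by_cases h : k ≤ i.castSucc
    · simpa only [h, forall_const] using! (measurableSet_Iio : MeasurableSet (Set.Iio (x i)))
    · simp [h]

/-- The union of the first `k + 1` gaps and the points between them. -/
def lowerGap (I : Set ℝ) {n : ℕ} (x : Fin n → ℝ) (k : Fin (n + 1)) : Set ℝ :=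
  {t | t ∈ I ∧ ∀ i : Fin n, k ≤ i.castSucc → t < x i}

lemma lowerGap_zero {n : ℕ} (x : Fin n → ℝ) : lowerGap I x 0 = gap I x 0 := by
  ext t; simp [lowerGap, gap]

lemma lowerGap_last {n : ℕ} (x : Fin n → ℝ) : lowerGap I x (Fin.last n) = I := by
  ext t
  simp only [lowerGap, Set.mem_ofPred_eq, and_iff_left_iff_imp]
  exact fun _ i hi => absurd hi (Fin.castSucc_lt_last i).not_ge

lemma lowerGap_castSucc {n : ℕ} {x : Fin n → ℝ} (hx : StrictMono x) (i : Fin n) :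
    lowerGap I x i.castSucc = I ∩ Set.Iio (x i) := by
  ext t
  simp only [lowerGap, Set.mem_ofPred_eq, Set.mem_inter_iff, Set.mem_Iio]
  refine and_congr_right fun _ => ⟨fun h => h i le_rfl, fun h j hj => h.trans_le ?_⟩
  exact hx.monotone (Fin.castSucc_le_castSucc_iff.1 hj)

lemma lowerGap_succ_ae_eq {n : ℕ} {x : Fin n → ℝ} (hx : StrictMono x) (i : Fin n) :
    lowerGap I x i.succ =ᵐ[volume] (I ∩ Set.Iio (x i) ∪ gap I x i.succ : Set ℝ) := by
  have h0 : ∀ᵐ t : ℝ, t ≠ x i := compl_mem_ae_iff.2 (measure_singleton (x i))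
  filter_upwards [h0] with t ht
  refine propext (show t ∈ lowerGap I x i.succ ↔ t ∈ (I ∩ Set.Iio (x i) ∪ gap I x i.succ) from ?_)
  simp only [lowerGap, gap, Set.mem_ofPred_eq, Set.mem_union, Set.mem_inter_iff, Set.mem_Iio]
  constructor
  · rintro ⟨hI, h⟩
    rcases lt_or_gt_of_ne ht with hlt | hgt
    · exact .inl ⟨hI, hlt⟩
    · refine .inr ⟨hI, fun j => ⟨fun hj => ?_, h j⟩⟩
      refine (hx.monotone ?_).trans_lt hgt
      exact Fin.castSucc_lt_succ_iff.1 hj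
  · rintro (⟨hI, h⟩ | ⟨hI, h⟩)
    · refine ⟨hI, fun j hj => h.trans (hx ?_)⟩
      exact Fin.succ_le_castSucc_iff.1 hj
    · exact ⟨hI, fun j hj => (h j).2 hj⟩

/-- The tensor `K` at `t` in the interaction picture. -/
def dressed (I : Set ℝ) (Q K : ℝ → Matrix ι ι ℂ) (t : ℝ) : Matrix ι ι ℂ :=
  propagator Q (I ∩ Set.Iio t) * K t * propagatorInv Q (I ∩ Set.Iio t)

/-- The composition law writes each gap propagator as `V(<xᵢ)⁻¹ V(<xᵢ₊₁)`, the dividing point being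
null. Afterwards each factor depends on one position only, whatever its neighbours are. -/
lemma pathCoeff_eq_dressed (hI : MeasurableSet I) {Q : ℝ → Matrix ι ι ℂ}
    (hQ : ∀ a b, IntegrableOn (fun t => Q t a b) I) (B : Matrix ι ι ℂ) {n : ℕ}
    (K : Fin n → ℝ → Matrix ι ι ℂ) {x : Fin n → ℝ} (hx : StrictMono x) :
    pathCoeff I B Q K x =
      (B * ((List.ofFn fun i => dressed I Q (K i) (x i)).prod * propagator Q I)).trace := by
  have hgap : ∀ i : Fin n, propagator Q (gap I x i.succ) =
      propagatorInv Q (I ∩ Set.Iio (x i)) * propagator Q (lowerGap I x i.succ) := by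
    intro i
    have hm : MeasurableSet (I ∩ Set.Iio (x i)) := hI.inter measurableSet_Iio
    have hsub : I ∩ Set.Iio (x i) ∪ gap I x i.succ ⊆ I :=
      Set.union_subset Set.inter_subset_left fun t ht => ht.1
    rw [propagator_congr_set Q (lowerGap_succ_ae_eq hx i),
      propagator_union hm (measurableSet_gap hI x _) ?_ fun a b => (hQ a b).mono_set hsub,
      ← Matrix.mul_assoc, propagatorInv_mul (fun a b =>
        (hQ a b).mono_set Set.inter_subset_left) hm, Matrix.one_mul]
    intro u hu v hv
    exact lt_trans hu.2 ((hv.2 i).1 (Fin.castSucc_lt_succ))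
  have key := prod_ofFn_telescope (fun k => propagator Q (lowerGap I x k)) (fun i => K i (x i))
    (fun i => propagatorInv Q (I ∩ Set.Iio (x i)))
  simp only [lowerGap_zero, lowerGap_last, lowerGap_castSucc hx, ← hgap] at key
  rw [pathCoeff, Matrix.mul_assoc, key]
  rfl

lemma pathCoeff_eq_zero (B : Matrix ι ι ℂ) (Q : ℝ → Matrix ι ι ℂ) {n : ℕ}
    (K : Fin n → ℝ → Matrix ι ι ℂ) (x : Fin n → ℝ) {i : Fin n} (h : K i (x i) = 0) :
    pathCoeff I B Q K x = 0 := by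
  rw [pathCoeff, List.prod_eq_zero, Matrix.mul_zero, Matrix.trace_zero]
  exact List.mem_ofFn.2 ⟨i, by simp [h]⟩

lemma pathCoeff_smul (c : ℂ) (B : Matrix ι ι ℂ) (Q : ℝ → Matrix ι ι ℂ) {n : ℕ}
    (K : Fin n → ℝ → Matrix ι ι ℂ) (x : Fin n → ℝ) :
    pathCoeff I (c • B) Q K x = c * pathCoeff I B Q K x := by
  simp [pathCoeff]

end PathCoeff

/-! ### Factorisation of the projector coefficients. -/

section Projector

variable {ι : Type} [Fintype ι] [DecidableEq ι] {I : Set ℝ} (A : CMPSTensors I ι)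

omit [DecidableEq ι] in
lemma map_star_mul (X Y : Matrix ι ι ℂ) : (X * Y).map star = X.map star * Y.map star :=
  Matrix.map_mul (f := starRingEnd ℂ)

omit [Fintype ι] in
lemma map_star_one : (1 : Matrix ι ι ℂ).map star = 1 :=
  Matrix.map_one _ (star_zero ℂ) (star_one ℂ)

lemma map_star_prod (l : List (Matrix ι ι ℂ)) :
    l.prod.map star = (l.map fun X => X.map star).prod :=
  map_list_prod (starRingEnd ℂ).mapMatrix l

omit [DecidableEq ι] in
lemma trace_map_star (X : Matrix ι ι ℂ) : (X.map star).trace = star X.trace := by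
  simp [Matrix.trace]

lemma propagator_projector {s : Set ℝ} (hs : MeasurableSet s) (hsI : s ⊆ I) :
    propagator (CMPOTensors.projector A).Q s = propagator A.Q s ⊗ₖ (propagator A.Q s).map star := by
  have hQ : ∀ a b, IntegrableOn (fun t => A.Q t a b) s := fun a b =>
    IntegrableOn.mono_set (A.integrable_Q a b) hsI
  rw [← propagator_map_star]
  exact propagator_kronecker hQ (integrableOn_map_star hQ) hs

lemma propagatorInv_projector {s : Set ℝ} (hs : MeasurableSet s)
    (hsI : s ⊆ I) : propagatorInv (CMPOTensors.projector A).Q s =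
      propagatorInv A.Q s ⊗ₖ (propagatorInv A.Q s).map star := by
  have hQ : ∀ a b, IntegrableOn (fun t => A.Q t a b) s := fun a b =>
    IntegrableOn.mono_set (A.integrable_Q a b) hsI
  have hQ' : ∀ a b, IntegrableOn (fun t => (CMPOTensors.projector A).Q t a b) s := fun a b =>
    IntegrableOn.mono_set ((CMPOTensors.projector A).integrable_Q a b) hsI
  refine left_inv_eq_right_inv (propagatorInv_mul hQ' hs) ?_
  rw [propagator_projector A hs hsI, ← Matrix.mul_kronecker_mul, ← map_star_mul,
    propagator_mul_inv hQ hs, map_star_one, Matrix.one_kronecker_one]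

/-- The dressing matrices are themselves Kronecker products, and on the factor where the tensor is
trivial they cancel as `V V⁻¹ = 1`. -/
lemma dressed_projector (hI : MeasurableSet I) (k : Ladder) (hk : k ≠ Ladder.ad) (t : ℝ) :
    dressed I (CMPOTensors.projector A).Q ((CMPOTensors.projector A).tensor k) t =
      (if k ≠ Ladder.r then dressed I A.Q A.L t else 1) ⊗ₖ
        (if k ≠ Ladder.l then (dressed I A.Q A.L t).map star else 1) := by
  have hm : MeasurableSet (I ∩ Set.Iio t) := hI.inter measurableSet_Iio
  have hQ : ∀ a b, IntegrableOn (fun t => A.Q t a b) (I ∩ Set.Iio t) := fun a b =>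
    IntegrableOn.mono_set (A.integrable_Q a b) Set.inter_subset_left
  rw [dressed, propagator_projector A hm Set.inter_subset_left,
    propagatorInv_projector A hm Set.inter_subset_left]
  cases k with
  | l =>
    simp only [CMPOTensors.tensor, CMPOTensors.projector, ← Matrix.mul_kronecker_mul,
      Matrix.mul_one, ← map_star_mul, propagator_mul_inv hQ hm, map_star_one]
    simp [dressed]
  | r =>
    simp only [CMPOTensors.tensor, CMPOTensors.projector, ← Matrix.mul_kronecker_mul,
      Matrix.mul_one, ← map_star_mul, propagator_mul_inv hQ hm]
    simp [dressed]
  | ad => exact absurd rfl hk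

lemma strictMono_subConfig {N : ℕ} (S : Finset (Fin N)) {x : Fin N → ℝ} (hx : StrictMono x) :
    StrictMono (subConfig S x) := hx.comp (S.orderEmbOfFin rfl).strictMono

/-- The dressed product separates into its two Kronecker factors and the trace is multiplicative on
them; each factor is then read back as a coefficient on its own sub-configuration. -/
lemma pathCoeff_projector (hI : MeasurableSet I) {N : ℕ} {w : Fin N → Ladder}
    (hw : ∀ i, w i ≠ Ladder.ad) {x : Fin N → ℝ} (hx : StrictMono x) :
    pathCoeff I (CMPOTensors.projector A).B (CMPOTensors.projector A).Q
        (fun i => (CMPOTensors.projector A).tensor (w i)) x =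
      pathCoeff I A.B A.Q (fun _ => A.L) (subConfig (leftPlaces w) x) *
        star (pathCoeff I A.B A.Q (fun _ => A.L) (subConfig (rightPlaces w) x)) := by
  have hl := prod_ofFn_ite (leftPlaces w) fun i => dressed I A.Q A.L (x i)
  have hr := prod_ofFn_ite (rightPlaces w) fun i => (dressed I A.Q A.L (x i)).map star
  simp only [leftPlaces, rightPlaces, Finset.mem_filter, Finset.mem_univ, true_and] at hl hr
  rw [pathCoeff_eq_dressed hI (CMPOTensors.projector A).integrable_Q _ _ hx,
    pathCoeff_eq_dressed hI A.integrable_Q _ _ (strictMono_subConfig _ hx),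
    pathCoeff_eq_dressed hI A.integrable_Q _ _ (strictMono_subConfig _ hx), ← trace_map_star,
    map_star_mul, map_star_mul, map_star_prod, List.map_ofFn, ← Matrix.trace_kronecker,
    Matrix.mul_kronecker_mul, Matrix.mul_kronecker_mul,
    propagator_projector A hI subset_rfl]
  simp only [dressed_projector A hI _ (hw _), prod_ofFn_kronecker]
  rw [hl, hr]
  rfl

end Projector

/-! ### Path coefficients of direct sums and relabelled bond spaces. -/

section DirectSums

variable {ι : Type} [Fintype ι] [DecidableEq ι] {κ : Type} [Fintype κ] [DecidableEq κ] {I : Set ℝ}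

lemma dysonTerm_fromBlocks (Q : ℝ → Matrix ι ι ℂ) (Q' : ℝ → Matrix κ κ ℂ) (n : ℕ) (s : Set ℝ) :
    dysonTerm (fun t => Matrix.fromBlocks (Q t) 0 0 (Q' t)) n s =
      Matrix.fromBlocks (dysonTerm Q n s) 0 0 (dysonTerm Q' n s) := by
  induction n generalizing s with
  | zero => simp [dysonTerm]
  | succ n ih =>
    ext a b
    rw [dysonTerm_succ_apply]
    simp only [ih, Matrix.fromBlocks_multiply]
    rcases a with a | a <;> rcases b with b | b <;> simp [dysonTerm_succ_apply]

lemma propagator_fromBlocks (Q : ℝ → Matrix ι ι ℂ) (Q' : ℝ → Matrix κ κ ℂ) (s : Set ℝ) :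
    propagator (fun t => Matrix.fromBlocks (Q t) 0 0 (Q' t)) s =
      Matrix.fromBlocks (propagator Q s) 0 0 (propagator Q' s) := by
  ext a b
  simp only [propagator, dysonTerm_fromBlocks, Matrix.of_apply]
  rcases a with a | a <;> rcases b with b | b <;> simp

lemma prod_ofFn_fromBlocks {n : ℕ} (A : Fin n → Matrix ι ι ℂ) (C : Fin n → Matrix κ κ ℂ) :
    (List.ofFn fun i => Matrix.fromBlocks (A i) 0 0 (C i)).prod =
      Matrix.fromBlocks (List.ofFn A).prod 0 0 (List.ofFn C).prod := by
  induction n with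
  | zero => simp
  | succ n ih => simp [List.ofFn_succ, ih, Matrix.fromBlocks_multiply]

lemma pathCoeff_fromBlocks (B : Matrix ι ι ℂ) (B' : Matrix κ κ ℂ) (Q : ℝ → Matrix ι ι ℂ)
    (Q' : ℝ → Matrix κ κ ℂ) {n : ℕ} (K : Fin n → ℝ → Matrix ι ι ℂ)
    (K' : Fin n → ℝ → Matrix κ κ ℂ) (x : Fin n → ℝ) :
    pathCoeff I (Matrix.fromBlocks B 0 0 B') (fun t => Matrix.fromBlocks (Q t) 0 0 (Q' t))
      (fun i t => Matrix.fromBlocks (K i t) 0 0 (K' i t)) x =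
      pathCoeff I B Q K x + pathCoeff I B' Q' K' x := by
  simp only [pathCoeff, propagator_fromBlocks, Matrix.fromBlocks_multiply, prod_ofFn_fromBlocks,
    Matrix.mul_zero, Matrix.zero_mul, add_zero, zero_add]
  simp [Matrix.trace]

variable {m : ℕ} {ν : Fin m → Type} [∀ j, Fintype (ν j)] [∀ j, DecidableEq (ν j)]

lemma dysonTerm_blockDiagonal' (Q : ∀ j, ℝ → Matrix (ν j) (ν j) ℂ) (n : ℕ) (s : Set ℝ) :
    dysonTerm (fun t => Matrix.blockDiagonal' fun j => Q j t) n s =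
      Matrix.blockDiagonal' fun j => dysonTerm (Q j) n s := by
  induction n generalizing s with
  | zero => exact (Matrix.blockDiagonal'_one).symm
  | succ n ih =>
    ext ⟨i, a⟩ ⟨j, b⟩
    rw [dysonTerm_succ_apply]
    simp only [ih, ← Matrix.blockDiagonal'_mul]
    by_cases h : i = j
    · subst h
      simp [dysonTerm_succ_apply, Matrix.blockDiagonal'_apply]
    · simp [Matrix.blockDiagonal'_apply, h]

lemma propagator_blockDiagonal' (Q : ∀ j, ℝ → Matrix (ν j) (ν j) ℂ) (s : Set ℝ) :
    propagator (fun t => Matrix.blockDiagonal' fun j => Q j t) s =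
      Matrix.blockDiagonal' fun j => propagator (Q j) s := by
  ext ⟨i, a⟩ ⟨j, b⟩
  simp only [propagator, dysonTerm_blockDiagonal', Matrix.of_apply]
  by_cases h : i = j
  · subst h
    simp [Matrix.blockDiagonal'_apply]
  · simp [Matrix.blockDiagonal'_apply, h]

lemma prod_ofFn_blockDiagonal' {n : ℕ} (A : Fin n → ∀ j, Matrix (ν j) (ν j) ℂ) :
    (List.ofFn fun i => Matrix.blockDiagonal' (A i)).prod =
      Matrix.blockDiagonal' fun j => (List.ofFn fun i => A i j).prod := by
  induction n with
  | zero => exact (Matrix.blockDiagonal'_one (m' := ν)).symm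
  | succ n ih => simp [List.ofFn_succ, ih, Matrix.blockDiagonal'_mul]

lemma pathCoeff_blockDiagonal' (B : ∀ j, Matrix (ν j) (ν j) ℂ)
    (Q : ∀ j, ℝ → Matrix (ν j) (ν j) ℂ) {n : ℕ} (K : Fin n → ∀ j, ℝ → Matrix (ν j) (ν j) ℂ)
    (x : Fin n → ℝ) :
    pathCoeff I (Matrix.blockDiagonal' B) (fun t => Matrix.blockDiagonal' fun j => Q j t)
      (fun i t => Matrix.blockDiagonal' fun j => K i j t) x =
      ∑ j, pathCoeff I (B j) (Q j) (fun i => K i j) x := by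
  simp only [pathCoeff, propagator_blockDiagonal', ← Matrix.blockDiagonal'_mul,
    prod_ofFn_blockDiagonal', Matrix.trace_blockDiagonal']

lemma dysonTerm_submatrix (e : κ ≃ ι) (Q : ℝ → Matrix ι ι ℂ) (n : ℕ) (s : Set ℝ) :
    dysonTerm (fun t => (Q t).submatrix e e) n s = (dysonTerm Q n s).submatrix e e := by
  induction n generalizing s with
  | zero => simp [dysonTerm]
  | succ n ih =>
    ext a b
    rw [dysonTerm_succ_apply, Matrix.submatrix_apply, dysonTerm_succ_apply]
    simp only [ih, Matrix.submatrix_mul_equiv, Matrix.submatrix_apply]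

lemma propagator_submatrix (e : κ ≃ ι) (Q : ℝ → Matrix ι ι ℂ) (s : Set ℝ) :
    propagator (fun t => (Q t).submatrix e e) s = (propagator Q s).submatrix e e := by
  ext a b
  simp [propagator, dysonTerm_submatrix]

lemma prod_ofFn_submatrix (e : κ ≃ ι) {n : ℕ} (A : Fin n → Matrix ι ι ℂ) :
    (List.ofFn fun i => (A i).submatrix e e).prod = (List.ofFn A).prod.submatrix e e := by
  induction n with
  | zero => simp
  | succ n ih => simp [List.ofFn_succ, ih, Matrix.submatrix_mul_equiv]

lemma pathCoeff_submatrix (e : κ ≃ ι) (B : Matrix ι ι ℂ) (Q : ℝ → Matrix ι ι ℂ) {n : ℕ}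
    (K : Fin n → ℝ → Matrix ι ι ℂ) (x : Fin n → ℝ) :
    pathCoeff I (B.submatrix e e) (fun t => (Q t).submatrix e e)
      (fun i t => (K i t).submatrix e e) x = pathCoeff I B Q K x := by
  simp only [pathCoeff, propagator_submatrix, Matrix.submatrix_mul_equiv, prod_ofFn_submatrix]
  simp only [Matrix.trace, Matrix.diag_apply, Matrix.submatrix_apply]
  exact e.sum_comp fun i => (B * propagator Q (gap I x 0) *
    (List.ofFn fun i : Fin n => K i (x i) * propagator Q (gap I x i.succ)).prod) i i

end DirectSums

/-! ### Operations on represented operators. -/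

namespace CMPOTensors

variable {ι : Type} [Fintype ι] [DecidableEq ι] {κ : Type} [Fintype κ] [DecidableEq κ] {I : Set ℝ}

/-- Relabelling of the bond space. -/
def reindex (e : κ ≃ ι) (S : CMPOTensors I ι) : CMPOTensors I κ where
  B := S.B.submatrix e e
  Q := fun x => (S.Q x).submatrix e e
  L := fun x => (S.L x).submatrix e e
  R := fun x => (S.R x).submatrix e e
  T := fun x => (S.T x).submatrix e e
  integrable_Q a b := S.integrable_Q (e a) (e b)
  measurable_L a b := S.measurable_L (e a) (e b)
  measurable_R a b := S.measurable_R (e a) (e b)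
  measurable_T a b := S.measurable_T (e a) (e b)

lemma Represents.reindex {S : CMPOTensors I ι} {O : Fock I →L[ℂ] Fock I} (h : S.Represents O)
    (e : κ ≃ ι) : (S.reindex e).Represents O := by
  intro Φ Ψ hΦ hΨ
  have key : ∀ (N : ℕ) (w : Fin N → Ladder),
      (S.reindex e).integrand Φ Ψ w = S.integrand Φ Ψ w := by
    intro N w
    funext x
    have hK : (fun i => (S.reindex e).tensor (w i)) =
        fun i t => (S.tensor (w i) t).submatrix e e := by
      funext i; cases w i <;> rfl
    rw [integrand, integrand, hK]
    exact congrArg (· * _) (pathCoeff_submatrix e S.B S.Q (fun i => S.tensor (w i)) x)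
  simpa only [key] using h Φ Ψ hΦ hΨ

lemma Represents.scale {S : CMPOTensors I ι} {O : Fock I →L[ℂ] Fock I} (h : S.Represents O)
    (c : ℂ) : (S.scale c).Represents (c • O) := by
  intro Φ Ψ hΦ hΨ
  have key : ∀ (N : ℕ) (w : Fin N → Ladder),
      (S.scale c).integrand Φ Ψ w = fun x => c * S.integrand Φ Ψ w x := by
    intro N w
    funext x
    have hK : (fun i => (S.scale c).tensor (w i)) = fun i => S.tensor (w i) := by
      funext i; cases w i <;> rfl
    rw [integrand, integrand, hK, ← mul_assoc c]
    exact congrArg (· * _) (pathCoeff_smul c S.B S.Q (fun i => S.tensor (w i)) x)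
  obtain ⟨h1, h2⟩ := h Φ Ψ hΦ hΨ
  simp only [key, integral_const_mul, smul_apply, inner_smul_right]
  exact ⟨fun N w => (h1 N w).const_mul c, h2.mul_left c⟩

lemma Represents.oplus {S : CMPOTensors I ι} {S' : CMPOTensors I κ} {O O' : Fock I →L[ℂ] Fock I}
    (h : S.Represents O) (h' : S'.Represents O') : (S.oplus S').Represents (O + O') := by
  intro Φ Ψ hΦ hΨ
  have key : ∀ (N : ℕ) (w : Fin N → Ladder), (S.oplus S').integrand Φ Ψ w =
      fun x => S.integrand Φ Ψ w x + S'.integrand Φ Ψ w x := by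
    intro N w
    funext x
    have hK : (fun i => (S.oplus S').tensor (w i)) =
        fun i t => Matrix.fromBlocks (S.tensor (w i) t) 0 0 (S'.tensor (w i) t) := by
      funext i; cases w i <;> rfl
    rw [integrand, integrand, integrand, hK, ← add_mul]
    exact congrArg (· * _) (pathCoeff_fromBlocks S.B S'.B S.Q S'.Q (fun i => S.tensor (w i))
      (fun i => S'.tensor (w i)) x)
  obtain ⟨h1, h2⟩ := h Φ Ψ hΦ hΨ
  obtain ⟨h1', h2'⟩ := h' Φ Ψ hΦ hΨ
  simp only [key, add_apply, inner_add_right]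
  refine ⟨fun N w => (h1 N w).add (h1' N w), (h2.add h2').congr_fun ?_⟩
  exact fun W => integral_add (h1 _ _) (h1' _ _)

lemma Represents.directSum {m : ℕ} {ν : Fin m → Type} [∀ j, Fintype (ν j)]
    [∀ j, DecidableEq (ν j)] {S : ∀ j, CMPOTensors I (ν j)} {O : Fin m → Fock I →L[ℂ] Fock I}
    (h : ∀ j, (S j).Represents (O j)) : (directSum S).Represents (∑ j, O j) := by
  intro Φ Ψ hΦ hΨ
  have key : ∀ (N : ℕ) (w : Fin N → Ladder), (CMPOTensors.directSum S).integrand Φ Ψ w =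
      fun x => ∑ j, (S j).integrand Φ Ψ w x := by
    intro N w
    funext x
    have hK : (fun i => (CMPOTensors.directSum S).tensor (w i)) =
        fun i t => Matrix.blockDiagonal' fun j => (S j).tensor (w i) t := by
      funext i; cases w i <;> rfl
    simp only [integrand, hK, ← Finset.sum_mul]
    exact congrArg (· * _) (pathCoeff_blockDiagonal' (fun j => (S j).B) (fun j => (S j).Q)
      (fun i j => (S j).tensor (w i)) x)
  simp only [key, sum_apply, inner_sum]
  refine ⟨fun N w => integrable_finsetSum _ fun j _ => (h j Φ Ψ hΦ hΨ).1 N w, ?_⟩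
  refine (hasSum_sum fun j _ => (h j Φ Ψ hΦ hΨ).2).congr_fun fun W => ?_
  exact integral_finsetSum _ fun j _ => (h j Φ Ψ hΦ hΨ).1 _ _

end CMPOTensors

/-! ### Unitarity of phase rotations. -/

section Unitary

lemma one_add_sum_rankOne_mem_unitary {E : Type*} [NormedAddCommGroup E] [InnerProductSpace ℂ E]
    [CompleteSpace E] {m : ℕ} {ψ : Fin m → E} (horth : Orthonormal ℂ ψ) (a : Fin m → ℝ) :
    (1 + ∑ j, (Complex.exp (Complex.I * (a j : ℂ)) - 1) •
      InnerProductSpace.rankOne ℂ (ψ j) (ψ j) : E →L[ℂ] E) ∈ unitary (E →L[ℂ] E) := by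
  let proj : E → E →L[ℂ] E := fun v => InnerProductSpace.rankOne ℂ v v
  change (1 + ∑ j, (Complex.exp (Complex.I * (a j : ℂ)) - 1) • proj (ψ j)) ∈ _
  have hP : ∀ i j, proj (ψ i) * proj (ψ j) = if i = j then proj (ψ i) else 0 := by
    intro i j
    ext1 Φ
    have := orthonormal_iff_ite.1 horth i j
    by_cases h : i = j
    · subst h
      simp [proj, InnerProductSpace.rankOne_apply, horth.1 i]
    · simp [proj, InnerProductSpace.rankOne_apply, this, h]
  have hs : ∀ j, star (proj (ψ j)) = proj (ψ j) := by
    intro j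
    rw [ContinuousLinearMap.star_eq_adjoint]
    simp [proj]
  -- The hypothesis says `(1 + c j)(1 + d j) = 1`; it is used with `1 + c j` and `1 + d j` conjugate
  -- phases.
  have hprod : ∀ c d : Fin m → ℂ, (∀ j, c j + d j + c j * d j = 0) →
      (1 + ∑ j, c j • proj (ψ j)) * (1 + ∑ j, d j • proj (ψ j)) = 1 := by
    intro c d hcd
    simp only [add_mul, mul_add, one_mul, mul_one, Finset.sum_mul, Finset.mul_sum,
      smul_mul_smul_comm, hP, smul_ite, smul_zero, Finset.sum_ite_eq', Finset.mem_univ, if_true]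
    rw [add_assoc, ← Finset.sum_add_distrib, Finset.sum_eq_zero, add_zero]
    intro j _
    simp only [← add_smul]
    have : c j + (d j + c j * d j) = 0 := by rw [← hcd j]; ring
    rw [this, zero_smul]
  have hphase : ∀ j, star (Complex.exp (Complex.I * (a j : ℂ))) *
      Complex.exp (Complex.I * (a j : ℂ)) = 1 := by
    intro j
    rw [Complex.star_def, ← Complex.exp_conj, ← Complex.exp_add]
    simp
  have hstar : star (1 + ∑ j, (Complex.exp (Complex.I * (a j : ℂ)) - 1) • proj (ψ j)) =
      1 + ∑ j, star (Complex.exp (Complex.I * (a j : ℂ)) - 1) • proj (ψ j) := by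
    rw [star_add, star_one, star_sum]
    simp only [star_smul, hs]
  rw [Unitary.mem_iff, hstar]
  constructor
  · refine hprod _ _ fun j => ?_
    rw [star_sub, star_one]
    linear_combination hphase j
  · refine hprod _ _ fun j => ?_
    rw [star_sub, star_one]
    linear_combination hphase j

end Unitary

/-! ### Decomposition of cubes into ordered chambers. -/

section Chambers

variable {I : Set ℝ} {ι : Type} [Fintype ι] {N : ℕ}

/-- Lebesgue measure on `I^ι`. -/
abbrev piMeasure (I : Set ℝ) (ι : Type) [Fintype ι] : Measure (ι → ℝ) :=
  Measure.pi fun _ => (volume : Measure ℝ).restrict I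

lemma piMeasure_eq_restrict (I : Set ℝ) (ι : Type) [Fintype ι] :
    piMeasure I ι = volume.restrict (Set.univ.pi fun _ => I) := by
  rw [volume_pi, Measure.restrict_pi_pi]

lemma measurableSet_strictMono (N : ℕ) : MeasurableSet {x : Fin N → ℝ | StrictMono x} := by
  have e : {x : Fin N → ℝ | StrictMono x} = ⋂ i, ⋂ j, ⋂ _ : i < j, {x | x i < x j} := by
    ext x; simp [StrictMono]
  rw [e]
  exact .iInter fun i => .iInter fun j => .iInter fun _ =>
    measurableSet_lt (measurable_pi_apply i) (measurable_pi_apply j)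

lemma restrict_simplex (I : Set ℝ) (N : ℕ) :
    volume.restrict (simplex I N) = (cubeMeasure I N).restrict {x | StrictMono x} := by
  have e : simplex I N = {x | StrictMono x} ∩ Set.univ.pi fun _ => I := by
    ext x; simp [simplex, and_comm]
  rw [e, ← Measure.restrict_restrict (measurableSet_strictMono N)]
  exact congrArg (Measure.restrict · _) (piMeasure_eq_restrict I (Fin N)).symm

lemma measurableSet_simplex (hI : MeasurableSet I) (N : ℕ) : MeasurableSet (simplex I N) := by
  have e : simplex I N = {x | StrictMono x} ∩ Set.univ.pi fun _ => I := by
    ext x; simp [simplex, and_comm]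
  rw [e]
  exact (measurableSet_strictMono N).inter (.univ_pi fun _ => hI)

/-- Coincident coordinates lie on finitely many proper hyperplanes, which are null. -/
lemma ae_injective (I : Set ℝ) (ι : Type) [Fintype ι] :
    ∀ᵐ h ∂(piMeasure I ι), Function.Injective h := by
  rw [piMeasure_eq_restrict]
  refine ae_restrict_of_ae ?_
  have h0 : ∀ i j : ι, ∀ᵐ h : ι → ℝ, i ≠ j → h i ≠ h j := by
    intro i j
    by_cases hij : i = j
    · simp [hij]
    have hp := Measure.addHaar_submodule (volume : Measure (ι → ℝ))
      (LinearMap.ker (LinearMap.proj (R := ℝ) (φ := fun _ : ι => ℝ) i - LinearMap.proj j)) ?_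
    · filter_upwards [compl_mem_ae_iff.2 hp] with h hh _ he
      exact hh (by simp [he])
    · classical
      intro htop
      have hm : (Pi.single i 1 : ι → ℝ) ∈ LinearMap.ker
          (LinearMap.proj (R := ℝ) (φ := fun _ : ι => ℝ) i - LinearMap.proj j) := by
        rw [htop]; trivial
      simp [Ne.symm hij] at hm
  filter_upwards [ae_all_iff.2 fun i => ae_all_iff.2 fun j => h0 i j] with h hh i j hij
  by_contra hne
  exact hh i j hne hij

omit [Fintype ι] in
lemma coe_piCongrLeft_eq (σ : Fin N ≃ ι) :
    ⇑(MeasurableEquiv.piCongrLeft (fun _ : ι => ℝ) σ) = fun x => x ∘ σ.symm := by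
  funext x i
  obtain ⟨j, rfl⟩ := σ.surjective i
  simp [MeasurableEquiv.coe_piCongrLeft, Equiv.piCongrLeft_apply_apply]

lemma measurePreserving_comp_symm (I : Set ℝ) (σ : Fin N ≃ ι) :
    MeasurePreserving (fun x : Fin N → ℝ => x ∘ σ.symm) (cubeMeasure I N) (piMeasure I ι) :=
  coe_piCongrLeft_eq σ ▸
    measurePreserving_piCongrLeft (fun _ : ι => (volume : Measure ℝ).restrict I) σ

omit [Fintype ι] in
lemma measurableEmbedding_comp_symm (σ : Fin N ≃ ι) :
    MeasurableEmbedding (fun x : Fin N → ℝ => x ∘ σ.symm) :=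
  coe_piCongrLeft_eq σ ▸ (MeasurableEquiv.piCongrLeft (fun _ : ι => ℝ) σ).measurableEmbedding

lemma integrableOn_simplex_comp_symm {f : (ι → ℝ) → ℂ} (hf : Integrable f (piMeasure I ι))
    (σ : Fin N ≃ ι) : IntegrableOn (fun x => f (x ∘ σ.symm)) (simplex I N) := by
  rw [IntegrableOn, restrict_simplex]
  exact (((measurePreserving_comp_symm I σ).integrable_comp_emb
    (measurableEmbedding_comp_symm σ)).2 hf).restrict

lemma setIntegral_simplex_comp_symm_eq_zero {f : (ι → ℝ) → ℂ}
    (hf : ∀ᵐ h ∂(piMeasure I ι), f h = 0) (σ : Fin N ≃ ι) :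
    ∫ x in simplex I N, f (x ∘ σ.symm) = 0 := by
  rw [restrict_simplex]
  exact integral_eq_zero_of_ae
    (ae_restrict_of_ae ((measurePreserving_comp_symm I σ).quasiMeasurePreserving.ae hf))

/-- Decomposition of `I^ι` into the chambers given by the orderings of the coordinates. -/
lemma integral_eq_sum_simplex [DecidableEq ι] (e : Fin N ≃ ι) {f : (ι → ℝ) → ℂ}
    (hf : Integrable f (piMeasure I ι)) :
    ∫ h, f h ∂(piMeasure I ι) =
      ∑ σ : Fin N ≃ ι, ∫ x in simplex I N, f (x ∘ σ.symm) := by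
  let C : (Fin N ≃ ι) → Set (ι → ℝ) := fun σ => {h | StrictMono (h ∘ σ)}
  have hC : ∀ σ, MeasurableSet (C σ) := fun σ =>
    (measurable_pi_lambda (fun h : ι → ℝ => h ∘ σ) fun i => measurable_pi_apply (σ i))
      (measurableSet_strictMono N)
  have hdisj : Pairwise (Function.onFun Disjoint C) := by
    intro σ τ hne
    refine Set.disjoint_left.2 fun h hσ hτ => hne ?_
    -- Both orderings list the values of `h` increasingly; a strictly increasing list is determined
    -- by its range, and injectivity then recovers the ordering.
    have hinj : Function.Injective h := by
      have := (StrictMono.injective hσ).comp σ.symm.injective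
      simpa [Function.comp_assoc] using this
    have he : h ∘ σ = h ∘ τ := (StrictMono.range_inj hσ hτ).1 (by
      rw [σ.surjective.range_comp, τ.surjective.range_comp])
    ext i
    exact hinj (congrFun he i)
  have hcover : (⋃ σ, C σ) =ᵐ[piMeasure I ι] Set.univ := by
    filter_upwards [ae_injective I ι] with h hh
    refine propext (show h ∈ (⋃ σ, C σ) ↔ h ∈ Set.univ from ?_)
    simp only [Set.mem_iUnion, Set.mem_univ, iff_true]
    refine ⟨(Tuple.sort (h ∘ e)).trans e, ?_⟩
    exact (Tuple.monotone_sort (h ∘ e)).strictMono_of_injective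
      ((hh.comp e.injective).comp (Tuple.sort (h ∘ e)).injective)
  rw [← setIntegral_univ, ← setIntegral_congr_set hcover,
    integral_iUnion_fintype hC hdisj fun σ => hf.integrableOn]
  refine Finset.sum_congr rfl fun σ _ => ?_
  rw [← (measurePreserving_comp_symm I σ).setIntegral_preimage_emb
    (measurableEmbedding_comp_symm σ), restrict_simplex]
  have : (fun x : Fin N → ℝ => x ∘ σ.symm) ⁻¹' C σ = {x | StrictMono x} := by
    ext x; simp [C, Function.comp_assoc]
  rw [this]

lemma integral_eq_factorial_mul_simplex {f : (Fin N → ℝ) → ℂ}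
    (hf : Integrable f (cubeMeasure I N))
    (hsym : ∀ σ : Equiv.Perm (Fin N), (fun x => f (x ∘ σ)) =ᵐ[cubeMeasure I N] f) :
    ∫ x, f x ∂(cubeMeasure I N) = (N.factorial : ℂ) * ∫ x in simplex I N, f x := by
  rw [integral_eq_sum_simplex (Equiv.refl _) hf]
  have : ∀ σ : Fin N ≃ Fin N, ∫ x in simplex I N, f (x ∘ σ.symm) = ∫ x in simplex I N, f x := by
    intro σ
    rw [restrict_simplex]
    exact integral_congr_ae (ae_restrict_of_ae (hsym σ.symm))
  simp [this, Fintype.card_perm]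

end Chambers

/-! ### Products of simplices as sums over shuffles. -/

section Shuffle

variable {I : Set ℝ} {n p : ℕ}

/-- `F ⊗ G` on `I^(n+p)`, cut off to ordered configurations of both groups. -/
def splitProduct (I : Set ℝ) (F : (Fin n → ℝ) → ℂ) (G : (Fin p → ℝ) → ℂ)
    (h : Fin n ⊕ Fin p → ℝ) : ℂ :=
  (simplex I n).indicator F (h ∘ Sum.inl) * (simplex I p).indicator G (h ∘ Sum.inr)

variable {F : (Fin n → ℝ) → ℂ} {G : (Fin p → ℝ) → ℂ}

lemma measurePreserving_split (I : Set ℝ) (n p : ℕ) :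
    MeasurePreserving (MeasurableEquiv.sumPiEquivProdPi fun _ : Fin n ⊕ Fin p => ℝ)
      (piMeasure I (Fin n ⊕ Fin p)) ((cubeMeasure I n).prod (cubeMeasure I p)) :=
  measurePreserving_sumPiEquivProdPi fun _ => (volume : Measure ℝ).restrict I

lemma integrable_indicator_simplex (hI : MeasurableSet I) (hF : IntegrableOn F (simplex I n)) :
    Integrable ((simplex I n).indicator F) (cubeMeasure I n) := by
  have := hF.integrable_indicator (measurableSet_simplex hI n)
  have e := piMeasure_eq_restrict I (Fin n)
  rw [show cubeMeasure I n = _ from e]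
  exact this.restrict

lemma integral_indicator_simplex (hI : MeasurableSet I) :
    ∫ x, (simplex I n).indicator F x ∂(cubeMeasure I n) = ∫ x in simplex I n, F x := by
  have e := piMeasure_eq_restrict I (Fin n)
  rw [show cubeMeasure I n = _ from e, integral_indicator (measurableSet_simplex hI n),
    Measure.restrict_restrict (measurableSet_simplex hI n), Set.inter_eq_left.2]
  exact fun x hx => Set.mem_univ_pi.2 hx.1

lemma integrable_splitProduct (hI : MeasurableSet I) (hF : IntegrableOn F (simplex I n))
    (hG : IntegrableOn G (simplex I p)) :
    Integrable (splitProduct I F G) (piMeasure I (Fin n ⊕ Fin p)) :=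
  ((measurePreserving_split I n p).integrable_comp_emb (MeasurableEquiv.measurableEmbedding _)).2
    ((integrable_indicator_simplex hI hF).mul_prod (integrable_indicator_simplex hI hG))

lemma integral_splitProduct (hI : MeasurableSet I) :
    ∫ h, splitProduct I F G h ∂(piMeasure I (Fin n ⊕ Fin p)) =
      (∫ x in simplex I n, F x) * ∫ x in simplex I p, G x := by
  rw [← integral_indicator_simplex hI, ← integral_indicator_simplex hI, ← integral_prod_mul]
  exact (measurePreserving_split I n p).integral_comp (MeasurableEquiv.measurableEmbedding _)
    (fun z : (Fin n → ℝ) × (Fin p → ℝ) =>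
      (simplex I n).indicator F z.1 * (simplex I p).indicator G z.2)

lemma ae_indicator_simplex_eq_zero
    (hF : ∀ᵐ x ∂(cubeMeasure I n), x ∈ simplex I n → F x = 0) :
    ∀ᵐ x ∂(cubeMeasure I n), (simplex I n).indicator F x = 0 := by
  filter_upwards [hF] with x hx
  by_cases h : x ∈ simplex I n <;> simp [h, hx]

lemma splitProduct_ae_eq_zero_left
    (hF : ∀ᵐ x ∂(cubeMeasure I n), x ∈ simplex I n → F x = 0) :
    ∀ᵐ h ∂(piMeasure I (Fin n ⊕ Fin p)), splitProduct I F G h = 0 := by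
  have h1 := (Measure.quasiMeasurePreserving_fst (ν := cubeMeasure I p)).ae
    (ae_indicator_simplex_eq_zero hF)
  filter_upwards [(measurePreserving_split I n p).quasiMeasurePreserving.ae h1] with h hh
  exact mul_eq_zero_of_left hh _

lemma splitProduct_ae_eq_zero_right
    (hG : ∀ᵐ x ∂(cubeMeasure I p), x ∈ simplex I p → G x = 0) :
    ∀ᵐ h ∂(piMeasure I (Fin n ⊕ Fin p)), splitProduct I F G h = 0 := by
  have h1 := (Measure.quasiMeasurePreserving_snd (μ := cubeMeasure I n)).ae
    (ae_indicator_simplex_eq_zero hG)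
  filter_upwards [(measurePreserving_split I n p).quasiMeasurePreserving.ae h1] with h hh
  exact mul_eq_zero_of_right _ hh

variable {N : ℕ}

lemma splitProduct_comp_finSumEquivOfFinset {S : Finset (Fin N)} (hS : S.card = n)
    (hS' : Sᶜ.card = p) {x : Fin N → ℝ} (hx : x ∈ simplex I N) :
    splitProduct I F G (x ∘ finSumEquivOfFinset hS hS') =
      F (x ∘ S.orderEmbOfFin hS) * G (x ∘ Sᶜ.orderEmbOfFin hS') := by
  have h1 : (x ∘ finSumEquivOfFinset hS hS') ∘ Sum.inl = x ∘ S.orderEmbOfFin hS := by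
    funext i; simp
  have h2 : (x ∘ finSumEquivOfFinset hS hS') ∘ Sum.inr = x ∘ Sᶜ.orderEmbOfFin hS' := by
    funext i; simp
  rw [splitProduct, h1, h2, Set.indicator_of_mem, Set.indicator_of_mem]
  · exact ⟨fun i => hx.1 _, hx.2.comp (Sᶜ.orderEmbOfFin hS').strictMono⟩
  · exact ⟨fun i => hx.1 _, hx.2.comp (S.orderEmbOfFin hS).strictMono⟩

/-- The product of two integrals over ordered configurations is the sum over all shuffles. -/
lemma sum_shuffle_eq_mul (hI : MeasurableSet I) (hnp : n + p = N)
    (hF : IntegrableOn F (simplex I n)) (hG : IntegrableOn G (simplex I p))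
    (J : Finset (Fin N) → ℂ) (hJ : ∀ (S : Finset (Fin N)) (hS : S.card = n) (hS' : Sᶜ.card = p),
      J S = ∫ x in simplex I N, splitProduct I F G (x ∘ finSumEquivOfFinset hS hS')) :
    ∑ S ∈ Finset.univ.filter (fun S : Finset (Fin N) => S.card = n), J S =
      (∫ x in simplex I n, F x) * ∫ x in simplex I p, G x := by
  have hcompl : ∀ S : Finset (Fin N), S.card = n → Sᶜ.card = p := by
    intro S hS
    rw [Finset.card_compl, Fintype.card_fin]; omega
  rw [← integral_splitProduct hI, integral_eq_sum_simplex
    ((finSumFinEquiv.trans (finCongr hnp)).symm) (integrable_splitProduct hI hF hG),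
    ← Finset.sum_subtype_eq_sum_filter, Finset.subtype_univ]
  -- A subset `S` selects the chamber in which the first group occupies the places `S`. It remains
  -- to see that distinct subsets give distinct chambers and that all other chambers contribute
  -- zero.
  refine Fintype.sum_of_injective
    (fun S : {S : Finset (Fin N) // S.card = n} =>
      (finSumEquivOfFinset S.2 (hcompl S.1 S.2)).symm) ?_ _ _ ?_ ?_
  · intro S T hST
    have h1 : finSumEquivOfFinset S.2 (hcompl S.1 S.2) =
      finSumEquivOfFinset T.2 (hcompl T.1 T.2) := Equiv.symm_bijective.injective hST
    have h2 : ⇑(S.1.orderEmbOfFin S.2) = T.1.orderEmbOfFin T.2 := by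
      funext i
      have := congrArg (fun e => e (Sum.inl i)) h1
      simpa using this
    have h3 := congrArg Set.range h2
    rw [Finset.range_orderEmbOfFin, Finset.range_orderEmbOfFin] at h3
    exact Subtype.ext (Finset.coe_injective h3)
  · intro σ hσ
    refine setIntegral_eq_zero_of_forall_eq_zero fun x hx => ?_
    by_contra hne
    refine hσ ?_
    have hl : StrictMono ((x ∘ σ.symm) ∘ Sum.inl) := by
      by_contra h
      exact hne (mul_eq_zero_of_left (Set.indicator_of_notMem (fun hm => h hm.2) _) _)
    have hr : StrictMono ((x ∘ σ.symm) ∘ Sum.inr) := by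
      by_contra h
      exact hne (mul_eq_zero_of_right _ (Set.indicator_of_notMem (fun hm => h hm.2) _))
    have hl' : StrictMono fun i : Fin n => σ.symm (Sum.inl i) := fun i j hij =>
      hx.2.lt_iff_lt.1 (hl hij)
    have hr' : StrictMono fun i : Fin p => σ.symm (Sum.inr i) := fun i j hij =>
      hx.2.lt_iff_lt.1 (hr hij)
    -- A nonvanishing integrand forces both groups to stay in order, so the chamber is the shuffle
    -- given by the places of the first group.
    let S : Finset (Fin N) := Finset.univ.map ⟨_, hl'.injective⟩
    have hS : S.card = n := by simp [S]
    refine ⟨⟨S, hS⟩, ?_⟩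
    have e1 := Finset.orderEmbOfFin_unique hS (fun i => by simp [S]) hl'
    have e2 := Finset.orderEmbOfFin_unique (hcompl S hS) (fun i => by simp [S]) hr'
    apply Equiv.symm_bijective.injective
    refine Equiv.ext fun i => ?_
    rcases i with i | i
    · simpa using (congrFun e1 i).symm
    · simpa using (congrFun e2 i).symm
  · rintro ⟨S, hS⟩
    exact hJ S hS (hcompl S hS)

end Shuffle

/-! ### Amplitudes and sector inner products. -/

section Amplitudes

variable {I : Set ℝ}

lemma wave_comp_perm (Φ : Fock I) (n : ℕ) (σ : Equiv.Perm (Fin n)) :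
    (fun x => wave Φ n (x ∘ σ)) =ᵐ[cubeMeasure I n] wave Φ n := by
  have h1 : permAct I n σ (Φ n : Lp ℂ 2 (cubeMeasure I n)) = Φ n := (Φ n).2 σ
  have h2 := Lp.coeFn_compMeasurePreserving (Φ n : Lp ℂ 2 (cubeMeasure I n))
    (measurePreserving_perm I n σ)
  have h3 : Lp.compMeasurePreserving (fun x : Fin n → ℝ => x ∘ σ) (measurePreserving_perm I n σ)
      (Φ n : Lp ℂ 2 (cubeMeasure I n)) = Φ n := h1
  rw [h3] at h2
  exact h2.symm

lemma wave_ae_eq_zero {Φ : Fock I} {n : ℕ} (h : Φ n = 0) :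
    ∀ᵐ x ∂(cubeMeasure I n), wave Φ n x = 0 := by
  rw [wave, h]
  exact Lp.coeFn_zero _ _ _

/-- The two factors `√n!` combine to `n!`, which offsets integrating over one chamber out of `n!`.
-/
lemma star_amplitude_mul_amplitude (Φ Ψ : Fock I) {n : ℕ} (x : Fin n → ℝ) :
    star (amplitude Φ x) * amplitude Ψ x =
      (n.factorial : ℂ) * ⟪wave Φ n x, wave Ψ n x⟫_ℂ := by
  have h : ((Real.sqrt (n.factorial : ℝ) : ℝ) : ℂ) * ((Real.sqrt (n.factorial : ℝ) : ℝ) : ℂ) =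
      (n.factorial : ℂ) := by
    rw [← Complex.ofReal_mul, Real.mul_self_sqrt (by positivity)]
    simp
  rw [amplitude, amplitude, ← h, RCLike.inner_apply, star_mul', Complex.star_def,
    Complex.conj_ofReal]
  ring

lemma integrable_star_amplitude_mul_amplitude (Φ Ψ : Fock I) (n : ℕ) :
    Integrable (fun x : Fin n → ℝ => star (amplitude Φ x) * amplitude Ψ x) (cubeMeasure I n) := by
  simp_rw [star_amplitude_mul_amplitude]
  exact (L2.integrable_inner (𝕜 := ℂ) (Φ n : Lp ℂ 2 (cubeMeasure I n)) (Ψ n)).const_mul _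

/-- The overlap of two `n`-particle vectors as an integral over ordered configurations. -/
lemma integral_star_amplitude_mul_amplitude (Φ Ψ : Fock I) (n : ℕ) :
    ∫ x in simplex I n, star (amplitude Φ x) * amplitude Ψ x = ⟪Φ n, Ψ n⟫_ℂ := by
  rw [Submodule.coe_inner, L2.inner_def, integral_eq_factorial_mul_simplex
    (L2.integrable_inner (𝕜 := ℂ) (Φ n : Lp ℂ 2 (cubeMeasure I n)) (Ψ n)), ← integral_const_mul]
  · simp_rw [star_amplitude_mul_amplitude]
    rfl
  · intro σ
    filter_upwards [wave_comp_perm Φ n σ, wave_comp_perm Ψ n σ] with x h1 h2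
    exact congrArg₂ (fun a b : ℂ => ⟪a, b⟫_ℂ) h1 h2

lemma integrableOn_star_amplitude_mul_amplitude (Φ Ψ : Fock I) (n : ℕ) :
    IntegrableOn (fun x : Fin n → ℝ => star (amplitude Φ x) * amplitude Ψ x) (simplex I n) := by
  rw [IntegrableOn, restrict_simplex]
  exact (integrable_star_amplitude_mul_amplitude Φ Ψ n).restrict

variable {ι : Type} [Fintype ι] [DecidableEq ι] {A : CMPSTensors I ι} {ψ : Fock I}

lemma CMPSTensors.IsState.amplitude_ae_eq (h : A.IsState ψ) (n : ℕ) :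
    ∀ᵐ x ∂(cubeMeasure I n), StrictMono x →
      amplitude ψ x = pathCoeff I A.B A.Q (fun _ : Fin n => A.L) x := by
  filter_upwards [h n] with x hx hmono
  have h0 : ((Real.sqrt (n.factorial : ℝ) : ℝ) : ℂ) ≠ 0 := by
    have : Real.sqrt (n.factorial : ℝ) ≠ 0 := by positivity
    exact_mod_cast this
  rw [amplitude, hx, Tuple.sort_eq_refl_iff_monotone.2 hmono.monotone, mul_inv_cancel_left₀ h0]
  rfl

lemma ae_simplex {n : ℕ} {P : (Fin n → ℝ) → Prop}
    (h : ∀ᵐ x ∂(cubeMeasure I n), StrictMono x → P x) :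
    ∀ᵐ x ∂(volume.restrict (simplex I n)), P x := by
  rw [restrict_simplex, ae_restrict_iff' (measurableSet_strictMono n)]
  exact h

end Amplitudes

/-! ### The Dyson series of the projector. -/

section Represents

variable {I : Set ℝ} {ι : Type} [Fintype ι] [DecidableEq ι]

instance : Fintype Ladder :=
  ⟨{Ladder.l, Ladder.r, Ladder.ad}, fun k => by cases k <;> simp⟩

/-- The part of the integrand of the projector that comes from the left factors. -/
def ketPart (A : CMPSTensors I ι) (Φ : Fock I) (n : ℕ) (y : Fin n → ℝ) : ℂ :=
  pathCoeff I A.B A.Q (fun _ => A.L) y * star (amplitude Φ y)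

/-- The part of the integrand of the projector that comes from the right factors. -/
def braPart (A : CMPSTensors I ι) (Ψ : Fock I) (n : ℕ) (y : Fin n → ℝ) : ℂ :=
  star (pathCoeff I A.B A.Q (fun _ => A.L) y) * amplitude Ψ y

variable {A : CMPSTensors I ι} {ψ : Fock I}

lemma ketPart_ae_eq (h : A.IsState ψ) (Φ : Fock I) (n : ℕ) :
    ketPart A Φ n =ᵐ[volume.restrict (simplex I n)]
      fun y => star (amplitude Φ y) * amplitude ψ y := by
  filter_upwards [ae_simplex (h.amplitude_ae_eq n)] with x hx
  rw [ketPart, hx, mul_comm]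

lemma braPart_ae_eq (h : A.IsState ψ) (Ψ : Fock I) (n : ℕ) :
    braPart A Ψ n =ᵐ[volume.restrict (simplex I n)]
      fun y => star (amplitude ψ y) * amplitude Ψ y := by
  filter_upwards [ae_simplex (h.amplitude_ae_eq n)] with x hx
  rw [braPart, hx]

lemma integrand_projector (hI : MeasurableSet I) (Φ Ψ : Fock I) {N : ℕ} {w : Fin N → Ladder}
    (hw : ∀ i, w i ≠ Ladder.ad) {x : Fin N → ℝ} (hx : x ∈ simplex I N) :
    (CMPOTensors.projector A).integrand Φ Ψ w x =
      splitProduct I (ketPart A Φ (leftPlaces w).card) (braPart A Ψ (leftPlaces w)ᶜ.card)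
        (x ∘ finSumEquivOfFinset rfl rfl) := by
  have hc : rightPlaces w = (leftPlaces w)ᶜ := by
    ext i
    simp only [rightPlaces, leftPlaces, Finset.mem_filter, Finset.mem_univ, true_and,
      Finset.mem_compl, not_not]
    have := hw i
    revert this
    cases w i <;> simp
  rw [splitProduct_comp_finSumEquivOfFinset rfl rfl hx, CMPOTensors.integrand,
    pathCoeff_projector A hI hw hx.2]
  -- The type of the sub-configuration depends on the cardinality, so the equality of place sets is
  -- transported through cardinality and configuration together.
  have h2 := congrArg (fun T : Finset (Fin N) => braPart A Ψ T.card (subConfig T x)) hc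
  rw [show braPart A Ψ (leftPlaces w)ᶜ.card (x ∘ (leftPlaces w)ᶜ.orderEmbOfFin rfl) = _ from h2.symm]
  rw [show ketPart A Φ (leftPlaces w).card (x ∘ (leftPlaces w).orderEmbOfFin rfl) =
    pathCoeff I A.B A.Q (fun _ => A.L) (subConfig (leftPlaces w) x) *
      star (amplitude Φ (subConfig (leftPlaces w) x)) from rfl, braPart]
  ring

lemma integrand_projector_eq_zero (Φ Ψ : Fock I) {N : ℕ} {w : Fin N → Ladder} {i : Fin N}
    (hw : w i = Ladder.ad) (x : Fin N → ℝ) :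
    (CMPOTensors.projector A).integrand Φ Ψ w x = 0 := by
  rw [CMPOTensors.integrand, pathCoeff_eq_zero (i := i), zero_mul]
  simp [hw, CMPOTensors.tensor, CMPOTensors.projector]

/-- The word that has `l` at the places `S` and `r` elsewhere. -/
def wordOf {N : ℕ} (S : Finset (Fin N)) (i : Fin N) : Ladder :=
  if i ∈ S then Ladder.l else Ladder.r

lemma wordOf_ne_ad {N : ℕ} (S : Finset (Fin N)) (i : Fin N) : wordOf S i ≠ Ladder.ad := by
  unfold wordOf; split_ifs <;> simp

lemma leftPlaces_wordOf {N : ℕ} (S : Finset (Fin N)) : leftPlaces (wordOf S) = S := by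
  ext i; by_cases h : i ∈ S <;> simp [leftPlaces, wordOf, h]

lemma wordOf_leftPlaces {N : ℕ} {w : Fin N → Ladder} (hw : ∀ i, w i ≠ Ladder.ad) :
    wordOf (leftPlaces w) = w := by
  funext i
  have := hw i
  simp only [wordOf, leftPlaces, Finset.mem_filter, Finset.mem_univ, true_and]
  revert this
  cases w i <;> simp

theorem projector_represents (hI : MeasurableSet I) (hψ : A.IsState ψ) :
    (CMPOTensors.projector A).Represents (proj ψ) := by
  intro Φ Ψ ⟨n₀, hn₀⟩ ⟨p₀, hp₀⟩
  have hket : ∀ n, IntegrableOn (ketPart A Φ n) (simplex I n) := fun n =>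
    (integrableOn_star_amplitude_mul_amplitude Φ ψ n).congr (ketPart_ae_eq hψ Φ n).symm
  have hbra : ∀ n, IntegrableOn (braPart A Ψ n) (simplex I n) := fun n =>
    (integrableOn_star_amplitude_mul_amplitude ψ Ψ n).congr (braPart_ae_eq hψ Ψ n).symm
  have hket' : ∀ n, ∫ x in simplex I n, ketPart A Φ n x = ⟪Φ n, ψ n⟫_ℂ := fun n => by
    rw [integral_congr_ae (ketPart_ae_eq hψ Φ n), integral_star_amplitude_mul_amplitude]
  have hbra' : ∀ n, ∫ x in simplex I n, braPart A Ψ n x = ⟪ψ n, Ψ n⟫_ℂ := fun n => by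
    rw [integral_congr_ae (braPart_ae_eq hψ Ψ n), integral_star_amplitude_mul_amplitude]
  refine ⟨fun N w => ?_, ?_⟩
  · by_cases hw : ∀ i, w i ≠ Ladder.ad
    · exact (integrableOn_simplex_comp_symm (integrable_splitProduct hI (hket _) (hbra _))
        (finSumEquivOfFinset rfl rfl).symm).congr_fun
        (fun x hx => (integrand_projector hI Φ Ψ hw hx).symm) (measurableSet_simplex hI N)
    · push Not at hw
      obtain ⟨i, hi⟩ := hw
      rw [show (CMPOTensors.projector A).integrand Φ Ψ w = fun _ => 0 from
        funext fun x => integrand_projector_eq_zero Φ Ψ hi x]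
      exact integrableOn_zero
  have hint : ∀ (N : ℕ) (w : Fin N → Ladder), (∀ i, w i ≠ Ladder.ad) →
      ∫ x in simplex I N, (CMPOTensors.projector A).integrand Φ Ψ w x =
      ∫ x in simplex I N, splitProduct I (ketPart A Φ (leftPlaces w).card)
        (braPart A Ψ (leftPlaces w)ᶜ.card) (x ∘ finSumEquivOfFinset rfl rfl) :=
    fun N w hw => setIntegral_congr_fun (measurableSet_simplex hI N) fun x hx =>
      integrand_projector hI Φ Ψ hw hx
  have hint0 : ∀ (N : ℕ) (w : Fin N → Ladder) (i : Fin N), w i = Ladder.ad →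
      ∫ x in simplex I N, (CMPOTensors.projector A).integrand Φ Ψ w x = 0 :=
    fun N w i hi => by simp [integrand_projector_eq_zero Φ Ψ hi]
  -- With `n₀ + p₀` or more places, either at least `n₀` are on the left or at least `p₀` on the
  -- right, and that amplitude vanishes almost everywhere.
  have hlarge : ∀ (N : ℕ) (w : Fin N → Ladder), n₀ + p₀ ≤ N →
      ∫ x in simplex I N, (CMPOTensors.projector A).integrand Φ Ψ w x = 0 := by
    intro N w hN
    by_cases hw : ∀ i, w i ≠ Ladder.ad
    · rw [hint N w hw]
      refine setIntegral_simplex_comp_symm_eq_zero ?_ (finSumEquivOfFinset rfl rfl).symm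
      have hcard : (leftPlaces w).card + (leftPlaces w)ᶜ.card = N := by
        rw [Finset.card_add_card_compl, Fintype.card_fin]
      rcases le_or_gt n₀ (leftPlaces w).card with h | h
      · refine splitProduct_ae_eq_zero_left ?_
        filter_upwards [wave_ae_eq_zero (hn₀ _ h)] with x hx _
        simp [ketPart, amplitude, hx]
      · refine splitProduct_ae_eq_zero_right ?_
        filter_upwards [wave_ae_eq_zero (hp₀ (leftPlaces w)ᶜ.card (by omega))] with x hx _
        simp [braPart, amplitude, hx]
    · push Not at hw
      obtain ⟨i, hi⟩ := hw
      exact hint0 N w i hi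
  -- Words without `Ad` correspond to their sets of left places; grouping these by cardinality gives
  -- the shuffle sums.
  have hfib : ∀ N : ℕ, ∑ w : Fin N → Ladder,
      ∫ x in simplex I N, (CMPOTensors.projector A).integrand Φ Ψ w x =
      ∑ np ∈ Finset.HasAntidiagonal.antidiagonal N, ⟪Φ np.1, ψ np.1⟫_ℂ * ⟪ψ np.2, Ψ np.2⟫_ℂ := by
    intro N
    rw [← Fintype.sum_of_injective (wordOf (N := N))
      (fun S T h => by rw [← leftPlaces_wordOf S, h, leftPlaces_wordOf])
      (fun S => ∫ x in simplex I N, (CMPOTensors.projector A).integrand Φ Ψ (wordOf S) x) _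
      (fun w hw => ?_) fun S => rfl]
    · rw [← Finset.sum_fiberwise_of_maps_to (s := Finset.univ) (t := Finset.HasAntidiagonal.antidiagonal N)
        (g := fun S : Finset (Fin N) => (S.card, Sᶜ.card)) (fun S _ => by
          rw [Finset.HasAntidiagonal.mem_antidiagonal, Finset.card_add_card_compl, Fintype.card_fin])]
      refine Finset.sum_congr rfl fun np hnp => ?_
      rw [Finset.HasAntidiagonal.mem_antidiagonal] at hnp
      rw [← hket', ← hbra', ← sum_shuffle_eq_mul hI hnp (hket _) (hbra _)
        (fun S => ∫ x in simplex I N, (CMPOTensors.projector A).integrand Φ Ψ (wordOf S) x)]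
      · refine Finset.sum_congr ?_ fun _ _ => rfl
        ext S
        simp only [Finset.mem_filter, Finset.mem_univ, true_and, Prod.ext_iff,
          Finset.card_compl, Fintype.card_fin]
        omega
      · obtain ⟨n, p⟩ := np
        dsimp only
        rintro S rfl rfl
        rw [hint N _ (wordOf_ne_ad S)]
        exact congrArg (fun T : Finset (Fin N) => ∫ x in simplex I N,
          splitProduct I (ketPart A Φ T.card) (braPart A Ψ Tᶜ.card)
            (x ∘ finSumEquivOfFinset (s := T) rfl rfl)) (leftPlaces_wordOf S)
    · by_contra hne
      refine hw ⟨leftPlaces w, wordOf_leftPlaces fun i hi => hne (hint0 N w i hi)⟩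
  have ha : Summable fun n => ‖⟪Φ n, ψ n⟫_ℂ‖ :=
    summable_of_ne_finset_zero (s := Finset.range n₀) fun n hn => by
      rw [hn₀ n (by simpa using hn)]; simp
  have hb : Summable fun n => ‖⟪ψ n, Ψ n⟫_ℂ‖ :=
    summable_of_ne_finset_zero (s := Finset.range p₀) fun n hn => by
      rw [hp₀ n (by simpa using hn)]; simp
  have hprod : HasSum (fun N => ∑ np ∈ Finset.HasAntidiagonal.antidiagonal N,
      ⟪Φ np.1, ψ np.1⟫_ℂ * ⟪ψ np.2, Ψ np.2⟫_ℂ) ⟪Φ, proj ψ Ψ⟫_ℂ := by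
    have h1 := (summable_norm_sum_mul_antidiagonal_of_summable_norm ha hb).of_norm.hasSum
    rw [← tsum_mul_tsum_eq_tsum_sum_antidiagonal_of_summable_norm ha hb,
      (lp.hasSum_inner Φ ψ).tsum_eq, (lp.hasSum_inner ψ Ψ).tsum_eq] at h1
    have h2 : ⟪Φ, proj ψ Ψ⟫_ℂ = ⟪Φ, ψ⟫_ℂ * ⟪ψ, Ψ⟫_ℂ := by
      rw [proj, InnerProductSpace.rankOne_apply, inner_smul_right, mul_comm]
    rwa [h2]
  -- The Cauchy product is the series summed by word length; finite support over words upgrades it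
  -- to the unconditional sum.
  refine hprod.sigma_of_hasSum (fun N => ?_) ?_
  · rw [← hfib N]
    exact hasSum_fintype _
  · refine summable_of_ne_finset_zero
      (s := (Finset.range (n₀ + p₀)).sigma fun N => (Finset.univ : Finset (Fin N → Ladder))) ?_
    rintro ⟨N, w⟩ hW
    exact hlarge N w (by simpa using hW)

end Represents

/-! ### The Dyson series of the identity. -/

section Identity

variable {I : Set ℝ}

lemma pathCoeff_identity {N : ℕ} (x : Fin N → ℝ) :
    pathCoeff I (CMPOTensors.identity I).B (CMPOTensors.identity I).Q
      (fun _ => (CMPOTensors.identity I).tensor Ladder.ad) x = 1 := by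
  have hl : (List.ofFn fun _ : Fin N => (1 : Matrix Unit Unit ℂ)).prod = 1 :=
    List.prod_eq_one fun a ha => by
      obtain ⟨_, rfl⟩ := List.mem_ofFn.1 ha; rfl
  simp only [pathCoeff, CMPOTensors.identity, CMPOTensors.tensor, propagator_zero, mul_one, hl]
  simp

/-- `P` ranges over all particle numbers since `S.card` and `N` are only propositionally equal; the
increasing enumeration of all places is the identity. -/
lemma subConfig_univ (P : ∀ n : ℕ, (Fin n → ℝ) → ℂ) {N : ℕ} {S : Finset (Fin N)}
    (hS : S = Finset.univ) (x : Fin N → ℝ) : P S.card (subConfig S x) = P N x := by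
  have hcard : S.card = N := by rw [hS, Finset.card_univ, Fintype.card_fin]
  have h : ∀ (n : ℕ) (h : S.card = n), P S.card (subConfig S x) = P n (x ∘ S.orderEmbOfFin h) := by
    rintro n rfl; rfl
  rw [h N hcard, ← Finset.orderEmbOfFin_unique hcard (f := id) (fun i => by simp [hS]) strictMono_id]
  rfl

lemma integrand_identity (Φ Ψ : Fock I) {N : ℕ} (x : Fin N → ℝ) :
    (CMPOTensors.identity I).integrand Φ Ψ (fun _ => Ladder.ad) x =
      star (amplitude Φ x) * amplitude Ψ x := by
  rw [CMPOTensors.integrand, pathCoeff_identity, one_mul,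
    subConfig_univ (fun n y => amplitude Φ y) (by simp [leftPlaces]),
    subConfig_univ (fun n y => amplitude Ψ y) (by simp [rightPlaces])]

lemma integrand_identity_eq_zero (Φ Ψ : Fock I) {N : ℕ} {w : Fin N → Ladder}
    (hw : w ≠ fun _ => Ladder.ad) (x : Fin N → ℝ) :
    (CMPOTensors.identity I).integrand Φ Ψ w x = 0 := by
  obtain ⟨i, hi⟩ := Function.ne_iff.1 hw
  rw [CMPOTensors.integrand, pathCoeff_eq_zero (i := i), zero_mul]
  revert hi
  cases w i <;> simp [CMPOTensors.tensor, CMPOTensors.identity]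

theorem identity_represents (I : Set ℝ) : (CMPOTensors.identity I).Represents 1 := by
  intro Φ Ψ ⟨n₀, hn₀⟩ _
  have had : ∀ N : ℕ, ∫ x in simplex I N,
      (CMPOTensors.identity I).integrand Φ Ψ (fun _ => Ladder.ad) x = ⟪Φ N, Ψ N⟫_ℂ := fun N => by
    simp_rw [integrand_identity]
    exact integral_star_amplitude_mul_amplitude Φ Ψ N
  have hne : ∀ (N : ℕ) (w : Fin N → Ladder), w ≠ (fun _ => Ladder.ad) →
      ∫ x in simplex I N, (CMPOTensors.identity I).integrand Φ Ψ w x = 0 := fun N w hw => by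
    simp [integrand_identity_eq_zero Φ Ψ hw]
  refine ⟨fun N w => ?_, ?_⟩
  · by_cases hw : w = fun _ => Ladder.ad
    · subst hw
      exact (integrableOn_star_amplitude_mul_amplitude Φ Ψ N).congr
        (.of_forall fun x => (integrand_identity Φ Ψ x).symm)
    · rw [show (CMPOTensors.identity I).integrand Φ Ψ w = fun _ => 0 from
        funext fun x => integrand_identity_eq_zero Φ Ψ hw x]
      exact integrableOn_zero
  · refine (lp.hasSum_inner Φ Ψ).sigma_of_hasSum (fun N => ?_) ?_
    · rw [← had N]
      exact hasSum_single _ fun w hw => hne N w hw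
    · refine summable_of_ne_finset_zero
        (s := (Finset.range n₀).sigma fun N => (Finset.univ : Finset (Fin N → Ladder))) ?_
      rintro ⟨N, w⟩ hW
      by_cases hw : w = fun _ => Ladder.ad
      · subst hw
        have : n₀ ≤ N := by simpa using hW
        rw [had N, hn₀ N this, inner_zero_left]
      · exact hne N w hw

end Identity

end CMPO
end

/-! ### Assembly of the matrix product unitary. -/

theorem mainTheorem5 (I : Set ℝ) (hI : I.OrdConnected) (m : ℕ) (D : Fin m → ℕ)
    (A : ∀ j, CMPO.CMPSTensors I (Fin (D j))) (ψ : Fin m → CMPO.Fock I)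
    (hψ : ∀ j, (A j).IsState (ψ j)) (horth : Orthonormal ℂ ψ) (a : Fin m → ℝ) :
    CMPO.IsCMPU (1 + ∑ j, D j ^ 2) (CMPO.phaseRotation ψ a) ∧
    (CMPO.CMPOTensors.identity I).Represents 1 ∧
    (∀ j, (CMPO.CMPOTensors.projector (A j)).Represents (CMPO.proj (ψ j))) ∧
    ((CMPO.CMPOTensors.identity I).oplus
      (CMPO.CMPOTensors.directSum fun j =>
        (CMPO.CMPOTensors.projector (A j)).scale
          (Complex.exp (Complex.I * (a j : ℂ)) - 1))).Represents
      (CMPO.phaseRotation ψ a) := by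
  have hproj : ∀ j, (CMPO.CMPOTensors.projector (A j)).Represents (CMPO.proj (ψ j)) := fun j =>
    CMPO.projector_represents hI.measurableSet (hψ j)
  have hU := (CMPO.identity_represents I).oplus (CMPO.CMPOTensors.Represents.directSum fun j =>
    (hproj j).scale (Complex.exp (Complex.I * (a j : ℂ)) - 1))
  -- The direct sum lives on a structured index type; counting it allows relabelling by `Fin`, as
  -- the bond dimension demands.
  have hcard : Fintype.card (Fin (1 + ∑ j, D j ^ 2)) =
      Fintype.card (Unit ⊕ Σ j, Fin (D j) × Fin (D j)) := by
    simp [sq]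
  exact ⟨⟨CMPO.one_add_sum_rankOne_mem_unitary horth a,
    _, hU.reindex (Fintype.equivOfCardEq hcard)⟩, CMPO.identity_represents I, hproj, hU⟩
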